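/- Assume the Riemann Hypothesis and let $\tfrac12<\sigma<1$. For $u<0$ let $\mathrm{Ei}(u)=\int_{-\infty}^{u}\frac{e^{t}}{t}\,dt$ be the exponential integral, and let $M(t)=\sum_{1\le n\le t}\mu(n)$ be the Mertens function. Then $y\mapsto \frac{1}{(\sigma+iy)\zeta(\sigma+iy)}$ belongs to $L^2(\mathbb R)$, and the integral equation $$\mathrm{Ei}(-e^{x})e^{\sigma x}-2\,\mathrm{Ei}(-2e^{x})e^{\sigma x}=e^{\sigma x}\int_{\mathbb R}\frac{e^{-\sigma y}}{e^{e^{x-y}}+1}\,\phi(y)\,dy$$ has a solution $\phi\in L^2(\mathbb R)$ (the equation holds for every $x\in\mathbb R$, with an absolutely convergent integral), given by $$\phi(x)=-\frac1{2\pi}\int_{\mathbb R}\frac{e^{-ixy}}{(\sigma+iy)\,\zeta(\sigma+iy)}\,dy$$ for every real $x$ that is not of the form $-\log n$ with $n\ge 1$ squarefree, where the integral converges as an improper integral (both limits of integration tending to infinity independently), and $$\phi(x)=-e^{\sigma x}M(e^{-x})\quad (x<0),\qquad \phi(x)=0\quad (x>0).$$ This solution is unique: every $\psi\in L^2(\mathbb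 R)$ (complex valued) that satisfies the equation for almost every $x$ equals $\phi$ almost everywhere. -/

import Mathlib

open MeasureTheory Filter Topology

noncomputable section

/-- The exponential integral `Ei x = ∫_{-∞}^x e^t / t dt` at a negative argument `x < 0`
(the only arguments at which it is used; for `x > 0` a principal value would be needed). -/
def Ei (x : ℝ) : ℝ := ∫ t in Set.Iic x, Real.exp t / t

/-- The Mertens function `M x = ∑_{n ≤ x} μ(n)` of a real variable. -/
def mertens (x : ℝ) : ℤ := ∑ n ∈ Finset.Icc 1 ⌊x⌋₊, ArithmeticFunction.moebius n

/-- The inhomogeneous term `h(x) = Ei(-e^x) e^{σx} - 2 Ei(-2e^x) e^{σx}`. -/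
def salemDatum (σ x : ℝ) : ℝ :=
  Ei (-Real.exp x) * Real.exp (σ * x) - 2 * Ei (-2 * Real.exp x) * Real.exp (σ * x)

/-- The integrand `e^{-σy} / (e^{e^{x-y}} + 1) · φ(y)`. -/
def salemIntegrand (σ : ℝ) (φ : ℝ → ℂ) (x y : ℝ) : ℂ :=
  ((Real.exp (-σ * y) / (Real.exp (Real.exp (x - y)) + 1) : ℝ) : ℂ) * φ y

/-- `φ` satisfies the integral equation at the point `x`, the integral being absolutely
convergent. -/
def SolvesSalemAt (σ : ℝ) (φ : ℝ → ℂ) (x : ℝ) : Prop :=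
  Integrable (salemIntegrand σ φ x) ∧
    (salemDatum σ x : ℂ) = (Real.exp (σ * x) : ℂ) * ∫ y, salemIntegrand σ φ x y

/-- The function `y ↦ 1 / ((σ + iy) ζ(σ + iy))`. -/
def zetaSymbol (σ y : ℝ) : ℂ :=
  1 / (((σ : ℂ) + Complex.I * y) * riemannZeta ((σ : ℂ) + Complex.I * y))

/-- `∫_{-∞}^{∞} f = a` as an improper integral: both ends tend to infinity independently. -/
def HasImproperIntegral (f : ℝ → ℂ) (a : ℂ) : Prop :=
  (∀ A B : ℝ, IntervalIntegrable f volume A B) ∧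
    Tendsto (fun p : ℝ × ℝ => ∫ y in (-p.1)..p.2, f y) (atTop ×ˢ atTop) (𝓝 a)

end

/-! After multiplication by e^{σx} the kernel depends on y - x only: the equation pairs φ with
translates of k(u) = e^{-σu}/(e^{e^{-u}}+1). The Fourier transform of k is the Mellin transform of
1/(e^v+1) on Re s = σ, that is Γ(s)(1-2^{1-s})ζ(s), which under RH has no zero when 1/2 < σ < 1
(`mellin_fermiFn_ne_zero`). By Plancherel an L² function orthogonal to almost all translates of k
vanishes (`ae_eq_zero_of_integral_translate_eq_zero`); this is uniqueness.

Existence is verified directly on φ(y) = -e^{σy}M(e^{-y}). The function M(e^{-y}) is the sum of μ(n)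
times the indicator of y ≤ -log n, so with X = e^x termwise integration gives Σ μ(n)T(nX), T being
`fermiTail`. Expanding 1/(e^v+1) = Σ_k (e^{-kv} - 2e^{-2kv}) gives T(z) = Σ_k f(kz) with f(z) =
E₁(z) - 2E₁(2z), and Möbius inversion leaves f(X) (`integral_mertens_mul`).

The Fourier formula rests on the bound 1/(sζ(s)) = O(|t|^{-3/4}) for σ ≤ Re s ≤ 2
(`exists_norm_recipMulZeta_le`), Littlewood's argument: Borel–Carathéodory bounds a branch of the
logarithm by O(log|t|), and the three lines theorem improves this to o(log|t|). The bound gives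
square integrability and lets the line of integration move from Re s = 2, where Perron's formula
produces M, to Re s = σ. Plancherel for the truncated integrals and Fatou's lemma then put φ in L²
(`memLp_of_tendsto_partial_fourier`). -/

/-! ### Holomorphic logarithms. -/

theorem exists_differentiableOn_exp_eq {U : Set ℂ} (hU : IsOpen U) (hc : Convex ℝ U)
    (hne : U.Nonempty) {F : ℂ → ℂ} (hF : DifferentiableOn ℂ F U) (h0 : ∀ z ∈ U, F z ≠ 0) :
    ∃ g : ℂ → ℂ, DifferentiableOn ℂ g U ∧ ∀ z ∈ U, Complex.exp (g z) = F z := by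
  have hsc : IsSimplyConnected U := by
    have := hc.contractibleSpace hne
    exact (inferInstance : SimplyConnectedSpace U)
  obtain ⟨g, hgc, hg⟩ := Complex.exists_continuousOn_eqOn_exp_comp hsc hU hF.continuousOn
    (by rintro ⟨z, hz, h⟩; exact h0 z hz h)
  refine ⟨g, fun z hz => ?_, hg⟩
  have hFz : DifferentiableAt ℂ F z := hF.differentiableAt (hU.mem_nhds hz)
  have hgz : ContinuousAt g z := hgc.continuousAt (hU.mem_nhds hz)
  -- Both sides are logarithms of F near z; continuity keeps the imaginary part of g w - g z inside
  -- (-π, π), where the principal logarithm inverts exp.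
  have key : g =ᶠ[𝓝 z] fun w => g z + Complex.log (F w / F z) := by
    have h1 : ∀ᶠ w in 𝓝 z, ‖g w - g z‖ < Real.pi := by
      have : Tendsto (fun w => ‖g w - g z‖) (𝓝 z) (𝓝 0) := by
        have := (hgz.sub (continuousAt_const (y := g z))).norm
        simpa [ContinuousAt] using this
      exact this.eventually_lt_const Real.pi_pos
    filter_upwards [h1, hU.mem_nhds hz] with w hw hwU
    rw [← show Complex.exp (g w) = F w from hg hwU, ← show Complex.exp (g z) = F z from hg hz,
      ← Complex.exp_sub, Complex.log_exp]
    · ring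
    · exact (abs_lt.1 ((Complex.abs_im_le_norm _).trans_lt hw)).1
    · exact (abs_lt.1 ((Complex.abs_im_le_norm _).trans_lt hw)).2.le
  have : DifferentiableAt ℂ (fun w => g z + Complex.log (F w / F z)) z := by
    refine DifferentiableAt.const_add _ (DifferentiableAt.clog (hFz.div_const _) ?_)
    rw [div_self (h0 z hz)]; exact Complex.one_mem_slitPlane
  exact (this.congr_of_eventuallyEq key).differentiableWithinAt

/-! ### Linear growth of (s-1)ζ(s)/s, and zero-freeness under RH. -/

/-- The fractional part of `t` on `(1, ∞)`, and `0` elsewhere. -/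
noncomputable def fractTail : ℝ → ℂ := Set.indicator (Set.Ioi 1) fun t => ((Int.fract t : ℝ) : ℂ)

theorem norm_fractTail_le (t : ℝ) : ‖fractTail t‖ ≤ 1 := by
  unfold fractTail
  by_cases h : t ∈ Set.Ioi (1 : ℝ)
  · rw [Set.indicator_of_mem h, Complex.norm_real, Real.norm_of_nonneg (Int.fract_nonneg t)]
    exact (Int.fract_lt_one t).le
  · simp [Set.indicator_of_notMem h]

theorem measurable_fractTail : Measurable fractTail :=
  (Complex.measurable_ofReal.comp measurable_fract).indicator measurableSet_Ioi

theorem differentiableAt_mellin_fractTail {s : ℂ} (hs : s.re < 0) :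
    DifferentiableAt ℂ (mellin fractTail) s := by
  -- Boundedness at infinity gives `a = 0`; the function vanishes near 0, so any `b` below Re s
  -- serves.
  refine mellin_differentiableAt_of_isBigO_rpow (a := 0) (b := s.re - 1) ?_ ?_ hs ?_ (by linarith)
  · refine LocallyIntegrable.locallyIntegrableOn ?_ _
    rw [locallyIntegrable_iff]
    intro k hk
    exact Measure.integrableOn_of_bounded (M := 1) hk.measure_lt_top.ne
      measurable_fractTail.aestronglyMeasurable (ae_of_all _ norm_fractTail_le)
  · refine Asymptotics.IsBigO.of_bound 1 (Eventually.of_forall fun t => ?_)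
    simpa using norm_fractTail_le t
  · refine Asymptotics.IsBigO.of_bound 1 ?_
    filter_upwards [Ioo_mem_nhdsGT (show (0 : ℝ) < 1 by norm_num)] with t ht
    rw [fractTail, Set.indicator_of_notMem (by simp [ht.2.le])]
    simp

theorem mellin_fractTail (s : ℂ) : mellin fractTail (-s) =
    ∫ t in Set.Ioi (1 : ℝ), ((Int.fract t : ℝ) : ℂ) * (t : ℂ) ^ (-(s + 1)) := by
  rw [mellin, ← integral_indicator measurableSet_Ioi, ← integral_indicator measurableSet_Ioi]
  congr 1
  ext t
  by_cases h : t ∈ Set.Ioi (1 : ℝ)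
  · have h' : t ∈ Set.Ioi (0 : ℝ) := zero_lt_one.trans (Set.mem_Ioi.1 h)
    rw [Set.indicator_of_mem h', Set.indicator_of_mem h, fractTail, Set.indicator_of_mem h,
      smul_eq_mul, mul_comm, show -s - 1 = -(s + 1) by ring]
  · by_cases h' : t ∈ Set.Ioi (0 : ℝ)
    · rw [Set.indicator_of_mem h', Set.indicator_of_notMem h, fractTail,
        Set.indicator_of_notMem h, smul_zero]
    · rw [Set.indicator_of_notMem h', Set.indicator_of_notMem h]

theorem integrableOn_fract_mul_cpow {s : ℂ} (hs : 0 < s.re) :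
    IntegrableOn (fun t : ℝ => ((Int.fract t : ℝ) : ℂ) * (t : ℂ) ^ (-(s + 1))) (Set.Ioi 1) := by
  refine Integrable.mono' (integrableOn_Ioi_rpow_of_lt (a := -(s.re + 1)) (c := 1)
    (by linarith) one_pos) ?_ ?_
  · refine ((Complex.measurable_ofReal.comp measurable_fract).mul ?_).aestronglyMeasurable
    exact Complex.measurable_ofReal.pow_const _
  · refine (ae_restrict_iff' measurableSet_Ioi).2 (ae_of_all _ fun t ht => ?_)
    have ht' : (0 : ℝ) < t := lt_trans zero_lt_one ht
    rw [norm_mul, Complex.norm_cpow_eq_rpow_re_of_pos ht', Complex.norm_real,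
      Real.norm_of_nonneg (Int.fract_nonneg t)]
    simp only [Complex.neg_re, Complex.add_re, Complex.one_re]
    exact mul_le_of_le_one_left (by positivity) (Int.fract_lt_one t).le

theorem norm_mellin_fractTail_le {s : ℂ} (hs : 0 < s.re) :
    ‖mellin fractTail (-s)‖ ≤ 1 / s.re := by
  rw [mellin_fractTail]
  have h := integral_Ioi_rpow_of_lt (a := -(s.re + 1)) (c := 1) (by linarith) one_pos
  have h2 : ∫ t in Set.Ioi (1 : ℝ), t ^ (-(s.re + 1)) = 1 / s.re := by
    rw [h, Real.one_rpow, show -(s.re + 1) + 1 = -s.re by ring, neg_div_neg_eq]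
  rw [← h2]
  refine norm_integral_le_of_norm_le (integrableOn_Ioi_rpow_of_lt (by linarith) one_pos) ?_
  refine (ae_restrict_iff' measurableSet_Ioi).2 (ae_of_all _ fun t ht => ?_)
  have ht' : (0 : ℝ) < t := lt_trans zero_lt_one ht
  rw [norm_mul, Complex.norm_cpow_eq_rpow_re_of_pos ht', Complex.norm_real,
    Real.norm_of_nonneg (Int.fract_nonneg t)]
  simp only [Complex.neg_re, Complex.add_re, Complex.one_re]
  exact mul_le_of_le_one_left (by positivity) (Int.fract_lt_one t).le

theorem riemannZeta₁_eq_sub_one_mul {s : ℂ} (hs : s ≠ 1) :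
    riemannZeta₁ s = (s - 1) * riemannZeta s := by
  rw [riemannZeta_eq_inv_sub_mul hs, mul_inv_cancel_left₀ (sub_ne_zero.2 hs)]

/-- Abel summation gives ζ(s) = s∫_1^∞ ⌊t⌋ t^{-s-1} dt; then ⌊t⌋ is split as t - {t}. -/
theorem riemannZeta₁_eq_of_one_lt_re {s : ℂ} (hs : 1 < s.re) :
    riemannZeta₁ s = s - (s - 1) * s * mellin fractTail (-s) := by
  have hs1 : s ≠ 1 := by rintro rfl; simp at hs
  have hs0 : s - 1 ≠ 0 := sub_ne_zero.2 hs1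
  have h := LSeries_eq_mul_integral (1 : ℕ → ℂ) (r := 1) zero_le_one hs
    (LSeriesSummable_one_iff.2 hs) (by
      refine Asymptotics.IsBigO.of_bound 1 (Eventually.of_forall fun n => ?_)
      simp)
  rw [LSeries_one_eq_riemannZeta hs] at h
  have hint := integral_Ioi_cpow_of_lt (a := -s) (c := 1) (by simpa using hs) one_pos
  have hI1 : IntegrableOn (fun t : ℝ => (t : ℂ) ^ (-s)) (Set.Ioi 1) :=
    integrableOn_Ioi_cpow_of_lt (by simpa using hs) one_pos
  have hI2 := integrableOn_fract_mul_cpow (s := s) (by linarith)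
  have h3 : ∫ t in Set.Ioi (1 : ℝ), (∑ k ∈ Finset.Icc 1 ⌊t⌋₊, (1 : ℕ → ℂ) k) * (t : ℂ) ^ (-(s + 1))
      = (∫ t in Set.Ioi (1 : ℝ), (t : ℂ) ^ (-s)) - mellin fractTail (-s) := by
    rw [mellin_fractTail, ← integral_sub hI1 hI2]
    refine setIntegral_congr_fun measurableSet_Ioi fun t ht => ?_
    have ht' : (0 : ℝ) < t := lt_trans zero_lt_one ht
    have h4 : (t : ℂ) ^ (-s) = t * (t : ℂ) ^ (-(s + 1)) := by
      rw [show -s = 1 + -(s + 1) by ring, Complex.cpow_add _ _ (by exact_mod_cast ht'.ne'),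
        Complex.cpow_one]
    simp only [h4, Pi.one_apply, Finset.sum_const, Nat.card_Icc, Nat.add_sub_cancel, nsmul_eq_mul,
      mul_one]
    rw [← sub_mul]
    congr 1
    have : (⌊t⌋₊ : ℝ) = t - Int.fract t := by
      rw [natCast_floor_eq_intCast_floor ht'.le]
      linarith [Int.self_sub_floor t]
    rw [← Complex.ofReal_natCast, this]
    push_cast; rfl
  have h5 : -s + 1 ≠ 0 := fun h => hs0 (by linear_combination -h)
  rw [h3, hint, Complex.ofReal_one, Complex.one_cpow] at h
  rw [riemannZeta₁_eq_sub_one_mul hs1, h]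
  have : -1 / (-s + 1) = 1 / (s - 1) := by
    rw [div_eq_div_iff h5 hs0]; ring
  rw [this]
  field_simp

/-- The Mellin integral of {t} still converges for Re s > 0, so the identity theorem extends the
formula from Re s > 1. -/
theorem riemannZeta₁_eq {s : ℂ} (hs : 0 < s.re) :
    riemannZeta₁ s = s - (s - 1) * s * mellin fractTail (-s) := by
  have ho : IsOpen {s : ℂ | 0 < s.re} := isOpen_lt continuous_const Complex.continuous_re
  have h1 : AnalyticOnNhd ℂ riemannZeta₁ {s : ℂ | 0 < s.re} :=
    differentiable_riemannZeta₁.differentiableOn.analyticOnNhd ho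
  have h2 : AnalyticOnNhd ℂ (fun s => s - (s - 1) * s * mellin fractTail (-s))
      {s : ℂ | 0 < s.re} := by
    refine DifferentiableOn.analyticOnNhd (fun s hs => ?_) ho
    have : DifferentiableAt ℂ (fun s => mellin fractTail (-s)) s :=
      (differentiableAt_mellin_fractTail (by simpa using hs)).comp s differentiableAt_id.neg
    exact DifferentiableAt.differentiableWithinAt (by fun_prop)
  refine h1.eqOn_of_preconnected_of_eventuallyEq h2
    (convex_halfSpace_re_gt 0).isPreconnected (z₀ := 2) (by simp) ?_ hs
  have : {s : ℂ | 1 < s.re} ∈ 𝓝 (2 : ℂ) :=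
    (isOpen_lt continuous_const Complex.continuous_re).mem_nhds (by simp)
  filter_upwards [this] with s hs using riemannZeta₁_eq_of_one_lt_re hs

/-- The Mellin factor is at most 1/Re s ≤ 2. Division by s makes the quotient and its inverse
bounded on Re s ≥ 3/2, as `exists_norm_inv_le_of_zero_free` needs. -/
theorem norm_riemannZeta₁_div_le {s : ℂ} (hs : 1 / 2 ≤ s.re) :
    ‖riemannZeta₁ s / s‖ ≤ 3 + 2 * ‖s‖ := by
  have h0 : s ≠ 0 := by rintro rfl; norm_num at hs
  rw [riemannZeta₁_eq (by linarith)]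
  have : (s - (s - 1) * s * mellin fractTail (-s)) / s = 1 - (s - 1) * mellin fractTail (-s) := by
    field_simp
  rw [this]
  have hm : ‖mellin fractTail (-s)‖ ≤ 2 := by
    refine (norm_mellin_fractTail_le (by linarith)).trans ?_
    rw [div_le_iff₀ (by linarith)]; linarith
  calc _ ≤ 1 + (‖s‖ + 1) * 2 := by
        refine (norm_sub_le _ _).trans (add_le_add (by simp) ?_)
        rw [norm_mul]
        refine mul_le_mul ((norm_sub_le _ _).trans (by simp)) hm (norm_nonneg _) (by positivity)
    _ = _ := by ring

theorem riemannZeta₁_ne_zero (hRH : RiemannHypothesis) {s : ℂ} (hs : 1 / 2 < s.re) :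
    riemannZeta₁ s ≠ 0 := by
  by_cases h1 : s = 1
  · simp [h1]
  rw [riemannZeta₁_eq_sub_one_mul h1]
  refine mul_ne_zero (sub_ne_zero.2 h1) fun h => ?_
  have := hRH s h (by
    rintro ⟨n, rfl⟩
    have : (-2 * ((n : ℂ) + 1)).re = -2 * ((n : ℝ) + 1) := by simp
    rw [this] at hs
    have : (0 : ℝ) ≤ n := n.cast_nonneg
    linarith) h1
  linarith

/-! ### Littlewood's bound for the reciprocal of a zero-free function. -/

/-- Turns the interpolated bound (log t)^{1-θ} into ε log t + C, hence into a power t^ε after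
exponentiation. -/
theorem exists_rpow_le_mul_add {κ δ : ℝ} (hκ : κ < 1) (hδ : 0 < δ) :
    ∃ C : ℝ, ∀ a : ℝ, 1 ≤ a → a ^ κ ≤ δ * a + C := by
  have h := (tendsto_rpow_neg_atTop (sub_pos.2 hκ)).eventually_lt_const hδ
  obtain ⟨N, hN⟩ := eventually_atTop.1 h
  refine ⟨max N 0, fun a ha => ?_⟩
  have ha0 : 0 < a := by linarith
  rcases le_total N a with hNa | hNa
  · have := hN a hNa
    have h2 : a ^ κ = a ^ (-(1 - κ)) * a := by
      rw [← Real.rpow_add_one ha0.ne']; congr 1; ring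
    rw [h2]
    nlinarith [le_max_right N 0]
  · have : a ^ κ ≤ a := by
      simpa using Real.rpow_le_rpow_of_exponent_le ha hκ.le
    have h1 := le_max_left N 0
    have : 0 < δ * a := by positivity
    linarith

theorem log_two_add_abs_le (t u : ℝ) :
    Real.log (2 + |t|) ≤ Real.log (2 + |u|) + |t - u| := by
  have h1 : 2 + |t| ≤ (2 + |u|) * Real.exp |t - u| := by
    have h2 : |t| ≤ |u| + |t - u| := by
      have := abs_add_le u (t - u); simpa using this
    have h3 := Real.add_one_le_exp |t - u|
    have h4 : (2 + |u|) * (|t - u| + 1) ≤ (2 + |u|) * Real.exp |t - u| := by gcongr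
    nlinarith [abs_nonneg u, abs_nonneg (t - u)]
  have h5 := Real.log_le_log (by positivity) h1
  rwa [Real.log_mul (by positivity) (Real.exp_pos _).ne', Real.log_exp] at h5

theorem abs_mul_exp_neg_sq_le (u : ℝ) : |u| * Real.exp (-u ^ 2) ≤ 1 := by
  rw [Real.exp_neg, ← div_eq_mul_inv, div_le_one (Real.exp_pos _)]
  have := Real.add_one_le_exp (u ^ 2)
  nlinarith [sq_abs u, sq_nonneg (|u| - 1), abs_nonneg u]

theorem norm_cexp_sub_mul_I_sq (s : ℂ) (t : ℝ) :
    ‖Complex.exp ((s - t * Complex.I) ^ 2)‖ = Real.exp (s.re ^ 2) * Real.exp (-(s.im - t) ^ 2) := by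
  rw [Complex.norm_exp, ← Real.exp_add]
  congr 1
  simp [pow_two, Complex.mul_re]
  ring

/-- Growth of a branch `g` of the logarithm of a function of polynomial growth: the bound
`O (log |t|)` near the left edge, from the Borel–Carathéodory theorem. -/
theorem norm_sub_le_of_log_branch {F g : ℂ → ℂ} {B l : ℝ} (hB : 1 ≤ B) (hl : 1 / 2 < l)
    (hg : DifferentiableOn ℂ g {s | 1 / 2 < s.re})
    (hgF : ∀ s : ℂ, 1 / 2 < s.re → Complex.exp (g s) = F s)
    (hgrow : ∀ s : ℂ, 1 / 2 < s.re → ‖F s‖ ≤ 3 + 2 * ‖s‖)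
    (hFB : ∀ s : ℂ, 3 / 2 ≤ s.re → ‖F s‖ ≤ B ∧ ‖(F s)⁻¹‖ ≤ B)
    {s : ℂ} (hs : l ≤ s.re) (hs2 : s.re ≤ 2) :
    ‖g s - g (2 + s.im * Complex.I)‖ ≤
      3 * (Real.log 5 + Real.log (2 + |s.im|) + Real.log B) / (l - 1 / 2) := by
  set c : ℂ := 2 + s.im * Complex.I with hc
  have hcre : c.re = 2 := by simp [hc]
  have hcim : c.im = s.im := by simp [hc]
  -- Bounds Re (g - g c) on the disc of radius 3/2 about c: linear growth gives log|F| ≤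
  -- log(5(2+|t|)), and -Re g(c) ≤ log B.
  set M : ℝ := Real.log 5 + Real.log (2 + |s.im|) + Real.log B with hM
  have hM0 : 0 < M := by
    have h1 : 0 < Real.log 5 := Real.log_pos (by norm_num)
    have h2 : 0 ≤ Real.log (2 + |s.im|) := Real.log_nonneg (by linarith [abs_nonneg s.im])
    have h3 : 0 ≤ Real.log B := Real.log_nonneg hB
    linarith
  have hre : ∀ z ∈ Metric.ball (0 : ℂ) (3 / 2), 1 / 2 < (c + z).re := by
    intro z hz
    have := (abs_lt.1 ((Complex.abs_re_le_norm z).trans_lt (mem_ball_zero_iff.1 hz))).1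
    rw [Complex.add_re, hcre]; linarith
  have hgc : -Real.log B ≤ (g c).re := by
    have h1 := (hFB c (by rw [hcre]; norm_num)).2
    rw [← hgF c (by rw [hcre]; norm_num), ← Complex.exp_neg, Complex.norm_exp] at h1
    have := (Real.le_log_iff_exp_le (by linarith)).2 h1
    simp at this; linarith
  have hnz : ‖s - c‖ = 2 - s.re := by
    have : s - c = ((s.re - 2 : ℝ) : ℂ) := by
      apply Complex.ext <;> simp [hc]
    rw [this, Complex.norm_real, Real.norm_eq_abs, abs_of_nonpos (by linarith)]; ring
  -- The radius 3/2 is the largest that keeps the disc about 2 + it in Re > 1/2. The gap R - |s - c|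
  -- is Re s - 1/2 ≥ l - 1/2, whence the denominator.
  have key := Complex.borelCaratheodory_zero (f := fun z => g (c + z) - g c) (M := M)
    (R := 3 / 2) (z := s - c) hM0 ?_ ?_ (by norm_num) ?_ (by simp)
  · simp only [add_sub_cancel] at key
    refine key.trans ?_
    rw [hnz]
    have h1 : 0 < 3 / 2 - (2 - s.re) := by linarith
    rw [div_le_div_iff₀ h1 (by linarith)]
    have h2 : 2 * M * (2 - s.re) ≤ 3 * M := by nlinarith
    have h3 : l - 1 / 2 ≤ 3 / 2 - (2 - s.re) := by linarith
    exact mul_le_mul h2 h3 (by linarith) (by positivity)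
  · refine DifferentiableOn.sub_const ?_ _
    exact hg.comp (by fun_prop) hre
  · intro z hz
    have h1 := hgrow (c + z) (hre z hz)
    rw [← hgF _ (hre z hz), Complex.norm_exp] at h1
    have hzn := mem_ball_zero_iff.1 hz
    have hcn : ‖c‖ ≤ 2 + |s.im| := by
      rw [hc]; refine (norm_add_le _ _).trans ?_
      simp
    have h2 : 3 + 2 * ‖c + z‖ ≤ 5 * (2 + |s.im|) := by
      have := norm_add_le c z
      have := abs_nonneg s.im
      linarith
    have h3 := (Real.le_log_iff_exp_le (by positivity)).2 (h1.trans h2)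
    rw [Real.log_mul (by norm_num) (by positivity)] at h3
    simp only [Set.mem_ofPred_eq, Complex.sub_re]
    linarith
  · rw [mem_ball_zero_iff, hnz]; linarith

/-- On Re s ≥ 2 the derivative g' = F'/F is bounded: Cauchy's estimate on discs of radius 1/2 gives
|F'| ≤ 2B, and |1/F| ≤ B. The bound depends on t - u alone, with no logarithm. -/
theorem norm_sub_le_of_log_branch_right {F g : ℂ → ℂ} {B : ℝ}
    (hF : DifferentiableOn ℂ F {s | 1 / 2 < s.re})
    (hg : DifferentiableOn ℂ g {s | 1 / 2 < s.re})
    (hgF : ∀ s : ℂ, 1 / 2 < s.re → Complex.exp (g s) = F s)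
    (hFB : ∀ s : ℂ, 3 / 2 ≤ s.re → ‖F s‖ ≤ B ∧ ‖(F s)⁻¹‖ ≤ B) (t u : ℝ) :
    ‖g (2 + t * Complex.I) - g (2 + u * Complex.I)‖ ≤ 2 * B ^ 2 * |t - u| := by
  have hU : IsOpen {s : ℂ | 1 / 2 < s.re} := isOpen_lt continuous_const Complex.continuous_re
  have hda : ∀ s : ℂ, 2 ≤ s.re → DifferentiableAt ℂ g s := fun s hs =>
    hg.differentiableAt (hU.mem_nhds (show 1 / 2 < s.re by linarith))
  have hder : ∀ s ∈ {s : ℂ | 2 ≤ s.re}, ‖deriv g s‖ ≤ 2 * B ^ 2 := by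
    intro s hs
    have hs : 2 ≤ s.re := hs
    have hdF : HasDerivAt F (Complex.exp (g s) * deriv g s) s := by
      refine HasDerivAt.congr_of_eventuallyEq (hda s hs).hasDerivAt.cexp ?_
      filter_upwards [hU.mem_nhds (show 1 / 2 < s.re by linarith)] with z hz using (hgF z hz).symm
    have hball : ∀ z ∈ Metric.closedBall s (1 / 2), 3 / 2 ≤ z.re := by
      intro z hz
      rw [mem_closedBall_iff_norm] at hz
      have := (abs_le.1 ((Complex.abs_re_le_norm (z - s)).trans hz)).1
      rw [Complex.sub_re] at this; linarith
    have h1 : ‖deriv F s‖ ≤ B / (1 / 2) := by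
      refine Complex.norm_deriv_le_of_forall_mem_sphere_norm_le (by norm_num) ?_ fun z hz =>
        (hFB z (hball z (Metric.sphere_subset_closedBall hz))).1
      refine DifferentiableOn.diffContOnCl_ball (U := {s | 1 / 2 < s.re}) hF fun z hz => ?_
      have := hball z hz
      show 1 / 2 < z.re
      linarith
    rw [hdF.deriv, hgF s (by linarith)] at h1
    obtain ⟨h2, h3⟩ := hFB s (by linarith)
    have h4 : F s ≠ 0 := by rw [← hgF s (by linarith)]; exact Complex.exp_ne_zero _
    have h5 : deriv g s = (F s)⁻¹ * (F s * deriv g s) := by field_simp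
    rw [h5, norm_mul]
    calc _ ≤ B * (B / (1 / 2)) := mul_le_mul h3 h1 (norm_nonneg _) ((norm_nonneg _).trans h3)
      _ = _ := by ring
  have := Convex.norm_image_sub_le_of_norm_deriv_le (s := {s : ℂ | 2 ≤ s.re})
    (x := 2 + u * Complex.I) (y := 2 + t * Complex.I) (fun s hs => hda s hs) hder
    (convex_halfSpace_re_ge 2) (by simp) (by simp)
  refine this.trans (le_of_eq ?_)
  rw [show (2 + t * Complex.I - (2 + u * Complex.I) : ℂ) = ((t - u : ℝ) : ℂ) * Complex.I by
    push_cast; ring, norm_mul, Complex.norm_real, Complex.norm_I, mul_one, Real.norm_eq_abs]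

set_option maxHeartbeats 1000000 in
/-- If `F` is zero free of polynomial growth on `Re s > 1/2`, and bounded together with its inverse
on `Re s ≥ 3/2`, then `1/F` is `O(|t|^ε)` on `β ≤ Re s ≤ 2`, for each `β > 1/2` and `ε > 0`. -/
theorem exists_norm_inv_le_of_zero_free {F : ℂ → ℂ} {B β ε : ℝ} (hB : 1 ≤ B)
    (hβ : 1 / 2 < β) (hβ2 : β < 2) (hε : 0 < ε)
    (hF : DifferentiableOn ℂ F {s | 1 / 2 < s.re})
    (hF0 : ∀ s : ℂ, 1 / 2 < s.re → F s ≠ 0)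
    (hgrow : ∀ s : ℂ, 1 / 2 < s.re → ‖F s‖ ≤ 3 + 2 * ‖s‖)
    (hFB : ∀ s : ℂ, 3 / 2 ≤ s.re → ‖F s‖ ≤ B ∧ ‖(F s)⁻¹‖ ≤ B) :
    ∃ C : ℝ, 0 < C ∧ ∀ s : ℂ, β ≤ s.re → s.re ≤ 2 → ‖(F s)⁻¹‖ ≤ C * (2 + |s.im|) ^ ε := by
  have hU : IsOpen {s : ℂ | 1 / 2 < s.re} := isOpen_lt continuous_const Complex.continuous_re
  obtain ⟨g, hg, hgF⟩ := exists_differentiableOn_exp_eq hU (convex_halfSpace_re_gt (1 / 2))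
    ⟨2, by norm_num⟩ hF hF0
  obtain ⟨l, hl, hlβ⟩ := exists_between hβ
  have hlogB : 0 ≤ Real.log B := Real.log_nonneg hB
  have hlog5 : 0 ≤ Real.log 5 := Real.log_nonneg (by norm_num)
  have hl0 : 0 < l - 1 / 2 := by linarith
  set K₁ : ℝ := 3 / (l - 1 / 2) with hK₁
  have hK₁0 : 0 < K₁ := by positivity
  set K : ℝ := K₁ * (1 + Real.log 5 + Real.log B) + 2 * B ^ 2 + K₁ with hK
  have hB2 : 1 ≤ B ^ 2 := one_le_pow₀ hB
  have hK1 : 1 ≤ K := by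
    have : 0 ≤ K₁ * (1 + Real.log 5 + Real.log B) := by positivity
    linarith
  have he4 : 1 ≤ Real.exp 4 := Real.one_le_exp (by norm_num)
  set b : ℝ := 2 * B ^ 2 * Real.exp 4 with hb
  have hb1 : 1 ≤ b := by nlinarith
  -- Relative position of β in [l, 2]; every s with Re s ≥ β has interpolation exponent at least θ₀
  -- > 0.
  set θ₀ : ℝ := (β - l) / (2 - l) with hθ₀
  have hθ₀0 : 0 < θ₀ := div_pos (by linarith) (by linarith)
  set K' : ℝ := K * Real.exp 4 with hK'
  have hK'1 : 1 ≤ K' := by nlinarith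
  -- This δ makes b·δ·a equal to ε(L + 2) for the a = K'(L + 2) below.
  obtain ⟨C', hC'⟩ := exists_rpow_le_mul_add (κ := 1 - θ₀) (δ := ε / (b * K')) (by linarith)
    (by positivity)
  refine ⟨Real.exp (Real.log B + b * C' + 2 * ε), Real.exp_pos _, fun s hs hs2 => ?_⟩
  set t₀ : ℝ := s.im with ht₀
  set L : ℝ := Real.log (2 + |t₀|) with hL
  have hL0 : 0 ≤ L := Real.log_nonneg (by linarith [abs_nonneg t₀])
  set a : ℝ := K' * (L + 2) with ha
  have ha1 : 1 ≤ a := by nlinarith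
  set c₀ : ℂ := 2 + t₀ * Complex.I with hc₀
  -- The Gaussian factor localises near height t₀: it absorbs the growth in |Im z - t₀|, so h is
  -- bounded on the strip, by a = O(log t₀), and on Re z = 2 by the constant b. The factor e^4
  -- bounds e^{(Re z)²}.
  set h : ℂ → ℂ := fun z => (g z - g c₀) * Complex.exp ((z - t₀ * Complex.I) ^ 2) with hh
  have hbase : ∀ z : ℂ, l ≤ z.re → z.re ≤ 2 → ‖g z - g c₀‖ ≤ K * (1 + L + |z.im - t₀|) := by
    intro z hz hz2
    have h1 := norm_sub_le_of_log_branch hB hl hg hgF hgrow hFB hz hz2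
    have h2 := norm_sub_le_of_log_branch_right hF hg hgF hFB z.im t₀
    have h3 := log_two_add_abs_le z.im t₀
    have h4 : ‖g z - g c₀‖ ≤ ‖g z - g (2 + z.im * Complex.I)‖ +
        ‖g (2 + z.im * Complex.I) - g c₀‖ := norm_sub_le_norm_sub_add_norm_sub _ _ _
    have h5 : 3 * (Real.log 5 + Real.log (2 + |z.im|) + Real.log B) / (l - 1 / 2) =
        K₁ * (Real.log 5 + Real.log (2 + |z.im|) + Real.log B) := by rw [hK₁]; ring
    have h6 : K₁ * (Real.log 5 + Real.log (2 + |z.im|) + Real.log B) ≤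
        K₁ * (Real.log 5 + (L + |z.im - t₀|) + Real.log B) := by gcongr
    have h7 : 0 ≤ |z.im - t₀| := abs_nonneg _
    rw [h5] at h1
    set W : ℝ := 1 + L + |z.im - t₀| with hW
    have h8 : Real.log 5 + (L + |z.im - t₀|) + Real.log B ≤
        (1 + Real.log 5 + Real.log B) * W := by
      nlinarith [mul_nonneg hlog5 (add_nonneg hL0 h7), mul_nonneg hlogB (add_nonneg hL0 h7)]
    have h9 : 2 * B ^ 2 * |z.im - t₀| ≤ 2 * B ^ 2 * W :=
      mul_le_mul_of_nonneg_left (by linarith) (by positivity)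
    have h10 : 0 ≤ K₁ * W := by positivity
    have h11 := mul_le_mul_of_nonneg_left h8 hK₁0.le
    calc _ ≤ K₁ * ((1 + Real.log 5 + Real.log B) * W) + 2 * B ^ 2 * W + K₁ * W := by linarith
      _ = K * W := by rw [hK]; ring
  have hexp : ∀ z : ℂ, l ≤ z.re → z.re ≤ 2 →
      ‖Complex.exp ((z - t₀ * Complex.I) ^ 2)‖ ≤ Real.exp 4 * Real.exp (-(z.im - t₀) ^ 2) := by
    intro z hz hz2
    rw [norm_cexp_sub_mul_I_sq]
    gcongr
    nlinarith
  have hha : ∀ z : ℂ, l ≤ z.re → z.re ≤ 2 → ‖h z‖ ≤ a := by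
    intro z hz hz2
    rw [hh, norm_mul]
    refine (mul_le_mul (hbase z hz hz2) (hexp z hz hz2) (norm_nonneg _)
      (by positivity)).trans ?_
    have h1 := abs_mul_exp_neg_sq_le (z.im - t₀)
    have h2 : Real.exp (-(z.im - t₀) ^ 2) ≤ 1 := Real.exp_le_one_iff.2 (by nlinarith)
    have h3 : (1 + L + |z.im - t₀|) * Real.exp (-(z.im - t₀) ^ 2) ≤ L + 2 := by
      nlinarith [mul_le_mul_of_nonneg_left h2 (show 0 ≤ 1 + L by linarith)]
    calc _ = K' * ((1 + L + |z.im - t₀|) * Real.exp (-(z.im - t₀) ^ 2)) := by rw [hK']; ring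
      _ ≤ a := by rw [ha]; gcongr
  have hhb : ∀ z : ℂ, z.re = 2 → ‖h z‖ ≤ b := by
    intro z hz
    have hz' : z = 2 + z.im * Complex.I := by apply Complex.ext <;> simp [hz]
    have h2 := norm_sub_le_of_log_branch_right hF hg hgF hFB z.im t₀
    rw [← hz'] at h2
    rw [hh, norm_mul]
    refine (mul_le_mul h2 (hexp z (by linarith) (by linarith)) (norm_nonneg _)
      (by positivity)).trans ?_
    have h1 := abs_mul_exp_neg_sq_le (z.im - t₀)
    calc _ = b * (|z.im - t₀| * Real.exp (-(z.im - t₀) ^ 2)) := by rw [hb]; ring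
      _ ≤ b := mul_le_of_le_one_right (by linarith) h1
  have hhd : DifferentiableOn ℂ h {s | 1 / 2 < s.re} :=
    (hg.sub_const _).mul (by fun_prop)
  have hclosed : ∀ z ∈ Complex.HadamardThreeLines.verticalClosedStrip l 2,
      l ≤ z.re ∧ z.re ≤ 2 := fun z hz => hz
  have h3l := Complex.HadamardThreeLines.norm_le_interp_of_mem_verticalClosedStrip'
    (f := h) (z := s) (a := a) (b := b) (l := l) (u := 2) (by linarith)
    (show s.re ∈ Set.Icc l 2 from ⟨by linarith, hs2⟩) ?_ ?_ ?_ ?_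
  rotate_left
  · refine DifferentiableOn.diffContOnCl (hhd.mono fun z hz => ?_)
    have : z ∈ Complex.HadamardThreeLines.verticalClosedStrip l 2 := by
      refine closure_minimal ?_ (isClosed_Icc.preimage Complex.continuous_re) hz
      exact Set.preimage_mono Set.Ioo_subset_Icc_self
    exact hl.trans_le (hclosed z this).1
  · exact ⟨a, by rintro _ ⟨z, hz, rfl⟩; exact hha z (hclosed z hz).1 (hclosed z hz).2⟩
  · intro z hz
    have hz : z.re = l := hz
    exact hha z hz.ge (by linarith)
  · exact fun z hz => hhb z hz
  set θ : ℝ := (s.re - l) / (2 - l) with hθ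
  have hθθ : θ₀ ≤ θ := by rw [hθ, hθ₀]; gcongr; linarith
  have hθ1 : θ ≤ 1 := (div_le_one (by linarith)).2 (by linarith)
  have h1 : a ^ (1 - θ) * b ^ θ ≤ a ^ (1 - θ₀) * b := by
    refine mul_le_mul (Real.rpow_le_rpow_of_exponent_le ha1 (by linarith)) ?_
      (by positivity) (by positivity)
    simpa using Real.rpow_le_rpow_of_exponent_le hb1 hθ1
  -- At height t₀ the Gaussian factor has modulus e^{(Re s)²} ≥ 1, so dropping it is harmless.
  have h2 : ‖g s - g c₀‖ ≤ ‖h s‖ := by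
    rw [hh, norm_mul, norm_cexp_sub_mul_I_sq, sub_self]
    refine le_mul_of_one_le_right (norm_nonneg _) ?_
    simpa using sq_nonneg s.re
  have h4 := hC' a ha1
  have h5 : -(g s).re ≤ Real.log B + b * C' + 2 * ε + L * ε := by
    have h6 : -Real.log B ≤ (g c₀).re := by
      have hc2 : c₀.re = 2 := by simp [hc₀]
      have h1 := (hFB c₀ (by rw [hc2]; norm_num)).2
      rw [← hgF c₀ (show 1 / 2 < c₀.re by rw [hc2]; norm_num), ← Complex.exp_neg,
        Complex.norm_exp] at h1
      have := (Real.le_log_iff_exp_le (by linarith)).2 h1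
      simp at this; linarith
    have h7 := (abs_le.1 ((Complex.abs_re_le_norm (g s - g c₀)).trans
      (h2.trans (h3l.trans h1)))).1
    rw [Complex.sub_re] at h7
    have h8 : a ^ (1 - θ₀) * b ≤ (ε / (b * K') * a + C') * b := by gcongr
    have h9 : (ε / (b * K') * a + C') * b = ε * (L + 2) + b * C' := by
      rw [ha]; field_simp
    linarith
  have hsU : 1 / 2 < s.re := by linarith
  rw [← hgF s hsU, ← Complex.exp_neg, Complex.norm_exp, Complex.neg_re,
    Real.rpow_def_of_pos (by positivity), ← Real.exp_add]
  exact Real.exp_le_exp.2 h5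

/-! ### Decay and square integrability of 1/(sζ(s)). -/

theorem summable_natCast_rpow_neg_three_halves : Summable fun n : ℕ => (n : ℝ) ^ (-(3 / 2) : ℝ) :=
  Real.summable_nat_rpow.2 (by norm_num)

theorem norm_LSeries_term_le {f : ℕ → ℂ} (hf : ∀ n, ‖f n‖ ≤ 1) {s : ℂ} {a : ℝ} (ha : a ≤ s.re)
    (n : ℕ) : ‖LSeries.term f s n‖ ≤ (n : ℝ) ^ (-a) := by
  rw [LSeries.norm_term_eq]
  split_ifs with h
  · positivity
  · have hn : 1 ≤ (n : ℝ) := by exact_mod_cast Nat.one_le_iff_ne_zero.2 h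
    rw [Real.rpow_neg (by positivity), ← one_div]
    gcongr
    exact hf n

theorem norm_LSeries_le_tsum {f : ℕ → ℂ} (hf : ∀ n, ‖f n‖ ≤ 1) {s : ℂ} (hs : 3 / 2 ≤ s.re) :
    ‖LSeries f s‖ ≤ ∑' n : ℕ, (n : ℝ) ^ (-(3 / 2) : ℝ) :=
  tsum_of_norm_bounded summable_natCast_rpow_neg_three_halves.hasSum (norm_LSeries_term_le hf hs)

theorem norm_moebius_le_one (n : ℕ) : ‖((ArithmeticFunction.moebius n : ℤ) : ℂ)‖ ≤ 1 := by
  rw [Complex.norm_intCast]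
  exact_mod_cast ArithmeticFunction.abs_moebius_le_one

theorem riemannZeta_mul_LSeries_moebius {s : ℂ} (hs : 1 < s.re) :
    riemannZeta s * LSeries (fun n => ((ArithmeticFunction.moebius n : ℤ) : ℂ)) s = 1 := by
  rw [← ArithmeticFunction.LSeries_zeta_eq_riemannZeta hs]
  exact ArithmeticFunction.LSeries_zeta_mul_Lseries_moebius hs

/-- For Re s ≥ 3/2 both ζ and 1/ζ are Dirichlet series with coefficients of modulus at most 1, so
bounded by Σ n^{-3/2}; (s-1)/s and its inverse are at most 3 in modulus. -/
theorem exists_bound_riemannZeta₁_div : ∃ B : ℝ, 1 ≤ B ∧ ∀ s : ℂ, 3 / 2 ≤ s.re →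
    ‖riemannZeta₁ s / s‖ ≤ B ∧ ‖(riemannZeta₁ s / s)⁻¹‖ ≤ B := by
  set Z : ℝ := ∑' n : ℕ, (n : ℝ) ^ (-(3 / 2) : ℝ) with hZ
  have hZ0 : 0 ≤ Z := tsum_nonneg fun n => by positivity
  refine ⟨1 + 3 * Z, by linarith, fun s hs => ?_⟩
  have hs1 : s ≠ 1 := by rintro rfl; norm_num at hs
  have hs0 : s ≠ 0 := by rintro rfl; norm_num at hs
  have hm1 : s - 1 ≠ 0 := sub_ne_zero.2 hs1
  have hsr : 3 / 2 ≤ ‖s‖ := hs.trans (Complex.re_le_norm s)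
  have hsr1 : 1 / 2 ≤ ‖s - 1‖ := by
    refine le_trans ?_ (Complex.re_le_norm (s - 1))
    rw [Complex.sub_re, Complex.one_re]; linarith
  have h1 : ‖riemannZeta s‖ ≤ Z := by
    rw [← LSeries_one_eq_riemannZeta (by linarith)]
    exact norm_LSeries_le_tsum (by simp) hs
  have h2 : ‖(riemannZeta s)⁻¹‖ ≤ Z := by
    rw [← eq_inv_of_mul_eq_one_right (riemannZeta_mul_LSeries_moebius (by linarith : 1 < s.re))]
    exact norm_LSeries_le_tsum norm_moebius_le_one hs
  have h3 : ‖(s - 1) / s‖ ≤ 3 := by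
    rw [norm_div, div_le_iff₀ (by linarith)]
    refine (norm_sub_le _ _).trans ?_
    rw [norm_one]; linarith
  have h4 : ‖s / (s - 1)‖ ≤ 3 := by
    rw [norm_div, div_le_iff₀ (by linarith)]
    have := norm_add_le (s - 1) 1
    rw [sub_add_cancel, norm_one] at this; linarith
  rw [riemannZeta₁_eq_sub_one_mul hs1]
  constructor
  · rw [mul_div_right_comm, norm_mul]
    have := mul_le_mul h3 h1 (norm_nonneg _) (by norm_num)
    linarith
  · rw [mul_div_right_comm, mul_inv, inv_div, norm_mul]
    have := mul_le_mul h4 h2 (norm_nonneg _) (by norm_num)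
    linarith

/-- The function `1 / (s ζ(s))`, with its removable singularity at `s = 1` removed. -/
noncomputable def recipMulZeta (s : ℂ) : ℂ := (s - 1) / (s * riemannZeta₁ s)

theorem recipMulZeta_eq {s : ℂ} (hs : s ≠ 1) : recipMulZeta s = 1 / (s * riemannZeta s) := by
  have h : s - 1 ≠ 0 := sub_ne_zero.2 hs
  rw [recipMulZeta, riemannZeta₁_eq_sub_one_mul hs, mul_left_comm, ← div_div, div_self h]

theorem zetaSymbol_eq_recipMulZeta {σ : ℝ} (hσ : σ ≠ 1) (y : ℝ) :
    zetaSymbol σ y = recipMulZeta (σ + Complex.I * y) := by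
  rw [recipMulZeta_eq, zetaSymbol]
  intro h
  have := congrArg Complex.re h
  simp at this
  exact hσ this

theorem recipMulZeta_eq_LSeries {s : ℂ} (hs : 1 < s.re) :
    recipMulZeta s = LSeries (fun n => ((ArithmeticFunction.moebius n : ℤ) : ℂ)) s / s := by
  have hs1 : s ≠ 1 := by rintro rfl; simp at hs
  rw [recipMulZeta_eq hs1, eq_inv_of_mul_eq_one_right (riemannZeta_mul_LSeries_moebius hs),
    one_div, mul_inv, div_eq_mul_inv, mul_comm]

theorem differentiableOn_recipMulZeta (hRH : RiemannHypothesis) :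
    DifferentiableOn ℂ recipMulZeta {s | 1 / 2 < s.re} := by
  intro s hs
  have hs : 1 / 2 < s.re := hs
  have hs0 : s ≠ 0 := by rintro rfl; norm_num at hs
  refine DifferentiableAt.differentiableWithinAt ?_
  exact DifferentiableAt.div (by fun_prop) (differentiableAt_id.mul
    differentiable_riemannZeta₁.differentiableAt)
    (mul_ne_zero hs0 (riemannZeta₁_ne_zero hRH hs))

/-- With F = (s-1)ζ(s)/s one has 1/(sζ(s)) = ((s-1)/s)·(1/s)·(1/F), and ε = 1/4 gives the exponent
-1 + 1/4. Being below -1/2, it suffices for square integrability. -/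
theorem exists_norm_recipMulZeta_le (hRH : RiemannHypothesis) {σ : ℝ} (hσ : 1 / 2 < σ)
    (hσ1 : σ < 1) : ∃ C : ℝ, 0 < C ∧ ∀ s : ℂ, σ ≤ s.re → s.re ≤ 2 →
      ‖recipMulZeta s‖ ≤ C * (2 + |s.im|) ^ (-(3 / 4) : ℝ) := by
  obtain ⟨B, hB, hFB⟩ := exists_bound_riemannZeta₁_div
  have hne : ∀ s : ℂ, 1 / 2 < s.re → s ≠ 0 := by
    rintro _ hs rfl; norm_num at hs
  obtain ⟨C, hC, hCs⟩ := exists_norm_inv_le_of_zero_free (F := fun s => riemannZeta₁ s / s)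
    (ε := 1 / 4) hB hσ (by linarith) (by norm_num)
    (fun s hs => (differentiable_riemannZeta₁.differentiableAt.div differentiableAt_id
      (hne s hs)).differentiableWithinAt)
    (fun s hs => div_ne_zero (riemannZeta₁_ne_zero hRH hs) (hne s hs))
    (fun s hs => norm_riemannZeta₁_div_le hs.le) hFB
  refine ⟨15 * C, by positivity, fun s hs hs2 => ?_⟩
  have hs0 := hne s (by linarith)
  have hz0 := riemannZeta₁_ne_zero hRH (s := s) (by linarith)
  have hsn : 1 / 2 ≤ ‖s‖ := le_trans (by linarith) (Complex.re_le_norm s)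
  have him := Complex.abs_im_le_norm s
  have h := hCs s hs hs2
  have h1 : ‖(s - 1) / s‖ ≤ 3 := by
    rw [norm_div, div_le_iff₀ (by linarith)]
    refine (norm_sub_le _ _).trans ?_
    rw [norm_one]; linarith
  have h2 : ‖s⁻¹‖ ≤ 5 * (2 + |s.im|)⁻¹ := by
    rw [norm_inv, inv_eq_one_div, ← div_eq_mul_inv, div_le_div_iff₀ (by linarith) (by positivity)]
    linarith
  have h3 : recipMulZeta s = (s - 1) / s * s⁻¹ * (riemannZeta₁ s / s)⁻¹ := by
    rw [recipMulZeta]; field_simp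
  rw [h3, norm_mul, norm_mul]
  calc _ ≤ 3 * (5 * (2 + |s.im|)⁻¹) * (C * (2 + |s.im|) ^ (1 / 4 : ℝ)) := by gcongr
    _ = 15 * C * ((2 + |s.im|) ^ (-1 : ℝ) * (2 + |s.im|) ^ (1 / 4 : ℝ)) := by
      rw [Real.rpow_neg_one]; ring
    _ = _ := by rw [← Real.rpow_add (by positivity)]; norm_num

theorem continuous_recipMulZeta_vertical (hRH : RiemannHypothesis) {c : ℝ} (hc : 1 / 2 < c) :
    Continuous fun y : ℝ => recipMulZeta (c + Complex.I * y) := by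
  refine (differentiableOn_recipMulZeta hRH).continuousOn.comp_continuous (by fun_prop) fun y => ?_
  simpa using hc

theorem memLp_zetaSymbol (hRH : RiemannHypothesis) {σ : ℝ} (hσ : 1 / 2 < σ) (hσ1 : σ < 1) :
    Continuous (zetaSymbol σ) ∧ MemLp (zetaSymbol σ) 2 volume := by
  obtain ⟨C, hC, hCs⟩ := exists_norm_recipMulZeta_le hRH hσ hσ1
  have heq : zetaSymbol σ = fun y : ℝ => recipMulZeta (σ + Complex.I * y) :=
    funext fun y => zetaSymbol_eq_recipMulZeta hσ1.ne y
  have hcont : Continuous (zetaSymbol σ) := heq ▸ continuous_recipMulZeta_vertical hRH hσ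
  refine ⟨hcont, ?_⟩
  rw [memLp_two_iff_integrable_sq_norm hcont.aestronglyMeasurable]
  have hI : Integrable (fun y : ℝ => C ^ 2 * (1 + ‖y‖) ^ (-(3 / 2) : ℝ)) :=
    (integrable_one_add_norm (by simp; norm_num)).const_mul _
  refine hI.mono' (hcont.norm.pow 2).aestronglyMeasurable (ae_of_all _ fun y => ?_)
  have h1 := hCs (σ + Complex.I * y) (by simp) (by simp; linarith)
  rw [← zetaSymbol_eq_recipMulZeta hσ1.ne] at h1
  simp only [Complex.add_im, Complex.ofReal_im, Complex.mul_im, Complex.I_re, Complex.I_im,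
    Complex.ofReal_re, zero_add, zero_mul, one_mul] at h1
  rw [Real.norm_of_nonneg (by positivity), Real.norm_eq_abs]
  calc ‖zetaSymbol σ y‖ ^ 2 ≤ (C * (2 + |y|) ^ (-(3 / 4) : ℝ)) ^ 2 := by gcongr
    _ = C ^ 2 * (2 + |y|) ^ (-(3 / 2) : ℝ) := by
      rw [mul_pow, ← Real.rpow_mul_natCast (by positivity)]; norm_num
    _ ≤ _ := by
      gcongr ?_ * ?_
      exact Real.rpow_le_rpow_of_nonpos (by positivity) (by linarith) (by norm_num)

/-! ### Perron's formula for the Mertens function on Re s = 2. -/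

/-- `t e^{-ct}` on the half-line `t > 0`. -/
noncomputable def rampExp (c t : ℝ) : ℂ := ((max t 0 * Real.exp (-c * t) : ℝ) : ℂ)

theorem continuous_rampExp (c : ℝ) : Continuous (rampExp c) := by
  unfold rampExp; fun_prop

theorem rampExp_of_nonpos {c t : ℝ} (ht : t ≤ 0) : rampExp c t = 0 := by
  simp [rampExp, max_eq_right ht]

theorem rampExp_eq_indicator (c : ℝ) : rampExp c = Set.indicator (Set.Ioi 0)
    fun t : ℝ => ((t ^ (1 : ℝ) * Real.exp (-c * t ^ (1 : ℝ)) : ℝ) : ℂ) := by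
  ext t
  by_cases h : t ∈ Set.Ioi (0 : ℝ)
  · rw [Set.indicator_of_mem h, rampExp, max_eq_left (le_of_lt h), Real.rpow_one]
  · rw [Set.indicator_of_notMem h, rampExp_of_nonpos (not_lt.1 h)]

theorem integrable_rampExp {c : ℝ} (hc : 0 < c) : Integrable (rampExp c) := by
  rw [rampExp_eq_indicator, integrable_indicator_iff measurableSet_Ioi]
  exact (integrableOn_rpow_mul_exp_neg_mul_rpow (by norm_num) (by norm_num) hc).ofReal

theorem integral_mul_cexp_neg_mul {z : ℂ} (hz : 0 < z.re)
    (hI : IntegrableOn (fun t : ℝ => (t : ℂ) * Complex.exp (-(z * t))) (Set.Ioi 0)) :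
    ∫ t : ℝ in Set.Ioi 0, (t : ℂ) * Complex.exp (-(z * t)) = (z ^ 2)⁻¹ := by
  have hz0 : z ≠ 0 := by rintro rfl; simp at hz
  have hnorm : ∀ t : ℝ, ‖Complex.exp (-(z * t))‖ = Real.exp (-(z.re * t)) := fun t => by
    rw [Complex.norm_exp]; simp
  have hlin : Tendsto (fun t : ℝ => z.re * t) atTop atTop := tendsto_id.const_mul_atTop hz
  have h1 : Tendsto (fun t : ℝ => (t : ℂ) * Complex.exp (-(z * t))) atTop (𝓝 0) := by
    rw [tendsto_zero_iff_norm_tendsto_zero]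
    have := ((Real.tendsto_pow_mul_exp_neg_atTop_nhds_zero 1).comp hlin).const_mul z.re⁻¹
    rw [mul_zero] at this
    refine this.congr' ?_
    filter_upwards [eventually_ge_atTop 0] with t ht
    rw [norm_mul, hnorm, Complex.norm_real, Real.norm_of_nonneg ht, Function.comp, pow_one,
      mul_assoc, inv_mul_cancel_left₀ hz.ne']
  have h2 : Tendsto (fun t : ℝ => Complex.exp (-(z * t))) atTop (𝓝 0) := by
    rw [tendsto_zero_iff_norm_tendsto_zero]
    simp_rw [hnorm]
    exact Real.tendsto_exp_neg_atTop_nhds_zero.comp hlin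
  have hd : ∀ t ∈ Set.Ici (0 : ℝ), HasDerivAt (fun t : ℝ =>
      -z⁻¹ * ((t : ℂ) * Complex.exp (-(z * t))) + -(z ^ 2)⁻¹ * Complex.exp (-(z * t)))
      ((t : ℂ) * Complex.exp (-(z * t))) t := by
    intro t _
    have h3 : HasDerivAt (fun t : ℝ => (t : ℂ)) 1 t := Complex.ofRealCLM.hasDerivAt
    have h4 : HasDerivAt (fun t : ℝ => Complex.exp (-(z * t)))
        (Complex.exp (-(z * t)) * (-(z * 1))) t := (h3.const_mul z).fun_neg.cexp
    refine (((h3.fun_mul h4).const_mul (-z⁻¹)).fun_add (h4.const_mul (-(z ^ 2)⁻¹))).congr_deriv ?_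
    field_simp
    ring
  have h5 := integral_Ioi_of_hasDerivAt_of_tendsto' hd hI
    ((h1.const_mul (-z⁻¹)).add (h2.const_mul (-(z ^ 2)⁻¹)))
  rw [h5]; simp

theorem fourier_rampExp {c : ℝ} (hc : 0 < c) (ξ : ℝ) :
    FourierTransform.fourier (rampExp c) ξ =
      (((c : ℂ) + Complex.I * ((2 * Real.pi * ξ : ℝ) : ℂ)) ^ 2)⁻¹ := by
  set z : ℂ := (c : ℂ) + Complex.I * ((2 * Real.pi * ξ : ℝ) : ℂ) with hz
  have hzre : z.re = c := by simp [hz]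
  rw [Real.fourier_real_eq_integral_exp_smul]
  have h2 : (fun v : ℝ => Complex.exp (((-2 * Real.pi * v * ξ : ℝ) : ℂ) * Complex.I) •
      rampExp c v) = Set.indicator (Set.Ioi 0) fun t : ℝ => (t : ℂ) * Complex.exp (-(z * t)) := by
    ext t
    by_cases ht : t ∈ Set.Ioi (0 : ℝ)
    · rw [Set.indicator_of_mem ht, rampExp, max_eq_left (le_of_lt ht), smul_eq_mul]
      push_cast
      rw [mul_left_comm, ← Complex.exp_add]
      congr 2
      rw [hz]; push_cast; ring
    · rw [Set.indicator_of_notMem ht, rampExp_of_nonpos (not_lt.1 ht), smul_zero]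
  rw [h2, integral_indicator measurableSet_Ioi]
  refine integral_mul_cexp_neg_mul (by rwa [hzre]) ?_
  rw [← integrable_indicator_iff measurableSet_Ioi, ← h2]
  refine (integrable_rampExp hc).bdd_mul (c := 1) (by fun_prop) (ae_of_all _ fun y => ?_)
  rw [Complex.norm_exp_ofReal_mul_I]

theorem ofReal_add_I_mul_ne_zero {c : ℝ} (hc : 0 < c) (y : ℝ) : (c : ℂ) + Complex.I * y ≠ 0 := by
  intro h
  have := congrArg Complex.re h
  simp at this
  exact hc.ne' this

theorem sq_norm_ofReal_add_I_mul (c y : ℝ) : ‖(c : ℂ) + Complex.I * y‖ ^ 2 = c ^ 2 + y ^ 2 := by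
  rw [← Complex.normSq_eq_norm_sq, Complex.normSq_apply]; simp; ring

theorem continuous_inv_ofReal_add_I_mul {c : ℝ} (hc : 0 < c) :
    Continuous fun y : ℝ => ((c : ℂ) + Complex.I * y)⁻¹ :=
  Continuous.inv₀ (by fun_prop) (ofReal_add_I_mul_ne_zero hc)

theorem continuous_inv_sq {c : ℝ} (hc : 0 < c) :
    Continuous fun y : ℝ => (((c : ℂ) + Complex.I * y) ^ 2)⁻¹ :=
  Continuous.inv₀ (by fun_prop) fun y => pow_ne_zero 2 (ofReal_add_I_mul_ne_zero hc y)

theorem integrable_inv_sq {c : ℝ} (hc : 0 < c) :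
    Integrable fun y : ℝ => (((c : ℂ) + Complex.I * y) ^ 2)⁻¹ := by
  have hI : Integrable fun y : ℝ => (1 + (c⁻¹ ^ 2)) * (1 + y ^ 2)⁻¹ :=
    integrable_inv_one_add_sq.const_mul _
  refine hI.mono' ?_ (ae_of_all _ fun y => ?_)
  · exact (continuous_inv_sq hc).aestronglyMeasurable
  · rw [norm_inv, norm_pow, sq_norm_ofReal_add_I_mul, ← div_eq_mul_inv, inv_eq_one_div,
      div_le_div_iff₀ (by positivity) (by positivity)]
    have : (1 + c⁻¹ ^ 2) * (c ^ 2 + y ^ 2) = c ^ 2 + y ^ 2 + 1 + c⁻¹ ^ 2 * y ^ 2 := by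
      field_simp
      ring
    nlinarith [sq_nonneg c, mul_nonneg (sq_nonneg c⁻¹) (sq_nonneg y)]

/-- Fourier inversion for the ramp. Squaring the denominator makes the integral absolutely
convergent and the inverse transform continuous, which 1/(c + iy) itself does not allow. -/
theorem integral_exp_mul_inv_sq {c : ℝ} (hc : 0 < c) (t : ℝ) :
    ∫ y : ℝ, Complex.exp (Complex.I * t * y) * (((c : ℂ) + Complex.I * y) ^ 2)⁻¹ =
      2 * Real.pi * rampExp c t := by
  have hint : Integrable (FourierTransform.fourier (rampExp c)) := by
    rw [show FourierTransform.fourier (rampExp c) = _ from funext (fourier_rampExp hc)]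
    have := (integrable_inv_sq hc).comp_mul_left' (R := 2 * Real.pi) (by positivity)
    exact this
  have h := congrFun ((continuous_rampExp c).fourierInv_fourier_eq (integrable_rampExp hc) hint) t
  rw [Real.fourierInv_eq', show FourierTransform.fourier (rampExp c) = _ from
    funext (fourier_rampExp hc)] at h
  have h2 := Measure.integral_comp_mul_left (fun y : ℝ =>
    Complex.exp (Complex.I * t * y) * (((c : ℂ) + Complex.I * y) ^ 2)⁻¹) (2 * Real.pi)
  rw [← h]
  have h3 : ∫ v : ℝ, Complex.exp (((2 * Real.pi * inner ℝ v t : ℝ) : ℂ) * Complex.I) •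
      (((c : ℂ) + Complex.I * ((2 * Real.pi * v : ℝ) : ℂ)) ^ 2)⁻¹ =
      ∫ v : ℝ, Complex.exp (Complex.I * t * ((2 * Real.pi * v : ℝ) : ℂ)) *
        (((c : ℂ) + Complex.I * ((2 * Real.pi * v : ℝ) : ℂ)) ^ 2)⁻¹ := by
    congr 1; ext v
    rw [smul_eq_mul]
    congr 2
    simp
    ring
  rw [h3, h2, abs_of_pos (by positivity), Complex.real_smul]
  push_cast
  have : (Real.pi : ℂ) ≠ 0 := by exact_mod_cast Real.pi_ne_zero
  field_simp

/-- The truncated Perron kernel, after an integration by parts. -/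
theorem integral_exp_div_eq {c t : ℝ} (hc : 0 < c) (ht : t ≠ 0) (a b : ℝ) :
    ∫ y in a..b, Complex.exp (Complex.I * t * y) * ((c : ℂ) + Complex.I * y)⁻¹ =
      (Complex.exp (Complex.I * t * b) * ((c : ℂ) + Complex.I * b)⁻¹ -
        Complex.exp (Complex.I * t * a) * ((c : ℂ) + Complex.I * a)⁻¹) / (Complex.I * t) +
      (∫ y in a..b, Complex.exp (Complex.I * t * y) * (((c : ℂ) + Complex.I * y) ^ 2)⁻¹) / t := by
  have ht' : (t : ℂ) ≠ 0 := by exact_mod_cast ht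
  have hIt : Complex.I * t ≠ 0 := mul_ne_zero Complex.I_ne_zero ht'
  have hu : ∀ x ∈ Set.uIcc a b, HasDerivAt (fun y : ℝ => ((c : ℂ) + Complex.I * y)⁻¹)
      (-Complex.I * (((c : ℂ) + Complex.I * x) ^ 2)⁻¹) x := by
    intro x _
    have h1 : HasDerivAt (fun y : ℝ => (c : ℂ) + Complex.I * y) Complex.I x := by
      simpa using ((hasDerivAt_id (x : ℂ)).comp_ofReal.const_mul Complex.I).const_add (c : ℂ)
    exact (h1.fun_inv (ofReal_add_I_mul_ne_zero hc x)).congr_deriv (div_eq_mul_inv _ _)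
  have hv : ∀ x ∈ Set.uIcc a b, HasDerivAt (fun y : ℝ => Complex.exp (Complex.I * t * y) /
      (Complex.I * t)) (Complex.exp (Complex.I * t * x)) x := by
    intro x _
    have h1 : HasDerivAt (fun y : ℝ => Complex.I * t * (y : ℂ)) (Complex.I * t) x := by
      simpa using (hasDerivAt_id (x : ℂ)).comp_ofReal.const_mul (Complex.I * t)
    exact (h1.cexp.div_const (Complex.I * t)).congr_deriv (mul_div_cancel_right₀ _ hIt)
  have h := intervalIntegral.integral_mul_deriv_eq_deriv_mul hu hv
    ((continuous_const.mul (continuous_inv_sq hc)).intervalIntegrable _ _)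
    (Continuous.intervalIntegrable (by fun_prop) _ _)
  have h1 : ∫ y in a..b, Complex.exp (Complex.I * t * y) * ((c : ℂ) + Complex.I * y)⁻¹ =
    ∫ x in a..b, ((c : ℂ) + Complex.I * x)⁻¹ * Complex.exp (Complex.I * t * x) := by
      congr 1; ext y; ring
  have h2 : ∫ x in a..b, (-Complex.I * (((c : ℂ) + Complex.I * x) ^ 2)⁻¹) *
      (Complex.exp (Complex.I * t * x) / (Complex.I * t)) =
      -((∫ y in a..b, Complex.exp (Complex.I * t * y) * (((c : ℂ) + Complex.I * y) ^ 2)⁻¹) / t) := by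
    rw [← intervalIntegral.integral_div, ← intervalIntegral.integral_neg]
    congr 1; ext y
    field_simp
  rw [h1, h, h2]
  ring

theorem norm_exp_I_mul_mul (t y : ℝ) : ‖Complex.exp (Complex.I * t * y)‖ = 1 := by
  rw [show Complex.I * t * y = ((t * y : ℝ) : ℂ) * Complex.I by push_cast; ring,
    Complex.norm_exp_ofReal_mul_I]

theorem norm_inv_ofReal_add_I_mul_le {c : ℝ} (hc : 0 < c) (y : ℝ) :
    ‖((c : ℂ) + Complex.I * y)⁻¹‖ ≤ c⁻¹ := by
  rw [norm_inv]
  refine inv_anti₀ hc ?_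
  simpa using Complex.re_le_norm ((c : ℂ) + Complex.I * y)

/-- Uniformity in the endpoints is the point: this is the majorant for passing to the limit under
the sum over n. -/
theorem exists_norm_integral_exp_div_le {c : ℝ} (hc : 0 < c) :
    ∃ K : ℝ, 0 ≤ K ∧ ∀ t : ℝ, t ≠ 0 → ∀ a b : ℝ, a ≤ b →
      ‖∫ y in a..b, Complex.exp (Complex.I * t * y) * ((c : ℂ) + Complex.I * y)⁻¹‖ ≤ K / |t| := by
  set Q : ℝ := ∫ y : ℝ, ‖(((c : ℂ) + Complex.I * y) ^ 2)⁻¹‖ with hQ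
  have hQ0 : 0 ≤ Q := integral_nonneg fun y => norm_nonneg _
  refine ⟨2 * c⁻¹ + Q, by positivity, fun t ht a b hab => ?_⟩
  rw [integral_exp_div_eq hc ht, add_div]
  refine (norm_add_le _ _).trans (add_le_add ?_ ?_)
  · rw [norm_div, norm_mul, Complex.norm_I, one_mul, Complex.norm_real, Real.norm_eq_abs]
    gcongr
    refine (norm_sub_le _ _).trans ?_
    rw [norm_mul, norm_mul, norm_exp_I_mul_mul, norm_exp_I_mul_mul]
    linarith [norm_inv_ofReal_add_I_mul_le hc a, norm_inv_ofReal_add_I_mul_le hc b]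
  · rw [norm_div, Complex.norm_real, Real.norm_eq_abs]
    gcongr
    refine (intervalIntegral.norm_integral_le_integral_norm hab).trans ?_
    rw [intervalIntegral.integral_of_le hab]
    refine le_trans (le_of_eq ?_) (setIntegral_le_integral (s := Set.Ioc a b) (integrable_inv_sq hc).norm
      (ae_of_all _ fun y => norm_nonneg _))
    refine integral_congr_ae (ae_of_all _ fun y => ?_)
    simp only [norm_mul, norm_exp_I_mul_mul, one_mul]

theorem tendsto_exp_div_zero (c t : ℝ) {l : Filter ℝ}
    (hl : Tendsto (fun y : ℝ => |y|) l atTop) :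
    Tendsto (fun y : ℝ => Complex.exp (Complex.I * t * y) * ((c : ℂ) + Complex.I * y)⁻¹) l
      (𝓝 0) := by
  refine squeeze_zero_norm' (a := fun y => |y|⁻¹) ?_ (tendsto_inv_atTop_zero.comp hl)
  filter_upwards [hl.eventually_gt_atTop 0] with y hy
  rw [norm_mul, norm_exp_I_mul_mul, one_mul, norm_inv]
  refine inv_anti₀ hy ?_
  simpa using Complex.abs_im_le_norm ((c : ℂ) + Complex.I * y)

/-- Perron's formula for a single term. -/
theorem tendsto_integral_exp_div {c t : ℝ} (hc : 0 < c) (ht : t ≠ 0) :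
    Tendsto (fun p : ℝ × ℝ => ∫ y in (-p.1)..p.2,
        Complex.exp (Complex.I * t * y) * ((c : ℂ) + Complex.I * y)⁻¹) (atTop ×ˢ atTop)
      (𝓝 (if 0 < t then 2 * Real.pi * Complex.exp (-c * t) else 0)) := by
  have ht' : (t : ℂ) ≠ 0 := by exact_mod_cast ht
  have hfst : Tendsto (fun p : ℝ × ℝ => -p.1) (atTop ×ˢ atTop) atBot :=
    tendsto_neg_atTop_atBot.comp tendsto_fst
  have hI : Integrable fun y : ℝ =>
      Complex.exp (Complex.I * t * y) * (((c : ℂ) + Complex.I * y) ^ 2)⁻¹ :=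
    (integrable_inv_sq hc).bdd_mul (c := 1) (by fun_prop)
      (ae_of_all _ fun y => (norm_exp_I_mul_mul t y).le)
  have h1 := intervalIntegral_tendsto_integral hI hfst
    (tendsto_snd : Tendsto Prod.snd (atTop ×ˢ atTop : Filter (ℝ × ℝ)) atTop)
  have h2 := (tendsto_exp_div_zero c t tendsto_abs_atTop_atTop).comp
    (tendsto_snd : Tendsto Prod.snd (atTop ×ˢ atTop : Filter (ℝ × ℝ)) atTop)
  have h3 := (tendsto_exp_div_zero c t tendsto_abs_atBot_atTop).comp hfst
  have h4 := ((h2.sub h3).div_const (Complex.I * t)).add (h1.div_const (t : ℂ))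
  rw [integral_exp_mul_inv_sq hc, sub_zero, zero_div, zero_add] at h4
  refine Tendsto.congr (fun p => ?_) (h4.trans (le_of_eq ?_))
  · rw [integral_exp_div_eq hc ht]; rfl
  · congr 1
    split_ifs with h
    · rw [rampExp, max_eq_left h.le]; push_cast; field_simp
    · rw [rampExp_of_nonpos (not_lt.1 h)]; simp

theorem term_moebius_eq (s : ℂ) (n : ℕ) :
    LSeries.term (fun n => ((ArithmeticFunction.moebius n : ℤ) : ℂ)) s n =
      (ArithmeticFunction.moebius n : ℤ) * Complex.exp (-(Real.log n : ℂ) * s) := by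
  rcases eq_or_ne n 0 with rfl | hn
  · simp
  rw [LSeries.term_of_ne_zero hn, Complex.cpow_def_of_ne_zero (by exact_mod_cast hn),
    ← Complex.natCast_log, neg_mul, Complex.exp_neg, div_eq_mul_inv]

/-- Expanding 1/(sζ(s)) = Σ μ(n)n^{-s}/s leaves one Perron integral per n, with parameter Λ n = -(x
+ log n), positive exactly when n < e^{-x}. The hypothesis on x excludes Λ n = 0 wherever μ(n) ≠ 0.
-/
theorem tendsto_integral_recipMulZeta_two {x : ℝ}
    (hx : ∀ n : ℕ, Squarefree n → x ≠ -Real.log n) :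
    Tendsto (fun p : ℝ × ℝ => ∫ y in (-p.1)..p.2,
        Complex.exp (-x * (2 + Complex.I * y)) * recipMulZeta (2 + Complex.I * y)) (atTop ×ˢ atTop)
      (𝓝 (2 * Real.pi * (mertens (Real.exp (-x)) : ℤ))) := by
  set Λ : ℕ → ℝ := fun n => -(x + Real.log n) with hΛ
  set a : ℕ → ℂ := fun n => (ArithmeticFunction.moebius n : ℤ) * Complex.exp (2 * Λ n) with ha
  have hΛ0 : ∀ n, ArithmeticFunction.moebius n ≠ 0 → Λ n ≠ 0 := by
    intro n hn h
    exact hx n (ArithmeticFunction.moebius_ne_zero_iff_squarefree.1 hn) (by simp only [hΛ] at h; linarith)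
  have han : ∀ n, ‖a n‖ ≤ Real.exp (-2 * x) * (n : ℝ) ^ (-2 : ℝ) := by
    intro n
    rcases eq_or_ne n 0 with rfl | hn
    · simp [ha]
    have hn' : (0 : ℝ) < n := by positivity
    rw [ha, norm_mul, Complex.norm_exp, Real.rpow_def_of_pos hn', ← Real.exp_add]
    refine (mul_le_of_le_one_left (by positivity) (norm_moebius_le_one n)).trans (le_of_eq ?_)
    congr 1
    have : (2 * (Λ n : ℂ)).re = 2 * Λ n := by
      rw [← Complex.ofReal_ofNat, ← Complex.ofReal_mul, Complex.ofReal_re]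
    rw [this]
    simp only [hΛ]; ring
  set P : ℝ × ℝ → ℝ → ℂ := fun p t => ∫ y in (-p.1)..p.2,
    Complex.exp (Complex.I * t * y) * (((2 : ℝ) : ℂ) + Complex.I * y)⁻¹ with hP
  have hsum2 : Summable fun n : ℕ => (n : ℝ) ^ (-2 : ℝ) := Real.summable_nat_rpow.2 (by norm_num)
  have hVP : ∀ p : ℝ × ℝ, ∫ y in (-p.1)..p.2,
      Complex.exp (-x * (2 + Complex.I * y)) * recipMulZeta (2 + Complex.I * y) =
      ∑' n, a n * P p (Λ n) := by
    intro p
    have h := intervalIntegral.hasSum_integral_of_dominated_convergence (μ := volume)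
      (a := -p.1) (b := p.2)
      (F := fun n y => a n * (Complex.exp (Complex.I * Λ n * y) *
        (((2 : ℝ) : ℂ) + Complex.I * y)⁻¹))
      (f := fun y : ℝ => Complex.exp (-x * (2 + Complex.I * y)) * recipMulZeta (2 + Complex.I * y))
      (fun n _ => Real.exp (-2 * x) * (n : ℝ) ^ (-2 : ℝ) * (2 : ℝ)⁻¹)
      (fun n => Continuous.aestronglyMeasurable (continuous_const.mul (Continuous.mul (by fun_prop)
        (continuous_inv_ofReal_add_I_mul two_pos))))
      (fun n => ae_of_all _ fun y _ => ?_)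
      (ae_of_all _ fun y _ => (hsum2.mul_left _).mul_right _)
      intervalIntegrable_const
      (ae_of_all _ fun y _ => ?_)
    · rw [← h.tsum_eq]
      refine tsum_congr fun n => ?_
      rw [intervalIntegral.integral_const_mul]
    · rw [norm_mul (a n), norm_mul (Complex.exp _), norm_exp_I_mul_mul, one_mul]
      exact mul_le_mul (han n) (norm_inv_ofReal_add_I_mul_le two_pos y) (norm_nonneg _)
        (by positivity)
    · have hs : 1 < ((2 : ℂ) + Complex.I * y).re := by simp
      have h1 := (ArithmeticFunction.LSeriesSummable_moebius_iff.2 hs).LSeriesHasSum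
      rw [recipMulZeta_eq_LSeries hs]
      have h2 := (h1.div_const ((2 : ℂ) + Complex.I * y)).mul_left
        (Complex.exp (-x * (2 + Complex.I * y)))
      refine h2.congr_fun ?_ |> id
      intro n
      rw [term_moebius_eq, ha]
      simp only []
      rw [div_eq_mul_inv, Complex.ofReal_ofNat, ← mul_assoc, ← mul_assoc]
      congr 1
      rw [mul_left_comm, mul_assoc, ← Complex.exp_add, ← Complex.exp_add]
      congr 2
      simp only [hΛ]; push_cast; ring
  obtain ⟨K, hK, hKb⟩ := exists_norm_integral_exp_div_le (c := 2) two_pos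
  have hlim : Tendsto (fun p => ∑' n, a n * P p (Λ n)) (atTop ×ˢ atTop)
      (𝓝 (∑' n, a n * (if 0 < Λ n then 2 * Real.pi * Complex.exp (-(2 : ℝ) * Λ n) else 0))) := by
    refine tendsto_tsum_of_dominated_convergence (bound := fun n => ‖a n‖ * (K / |Λ n|)) ?_ ?_ ?_
    · refine Summable.of_norm_bounded_eventually_nat
        (g := fun n => Real.exp (-2 * x) * (n : ℝ) ^ (-2 : ℝ) * K) ((hsum2.mul_left _).mul_right _) ?_
      have h1 : Tendsto (fun n : ℕ => Real.log n) atTop atTop :=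
        Real.tendsto_log_atTop.comp tendsto_natCast_atTop_atTop
      -- From here on |Λ n| ≥ 1, so K/|Λ n| ≤ K; the finitely many smaller n do not affect
      -- summability.
      filter_upwards [h1.eventually_ge_atTop (1 - x)] with n hn
      rw [Real.norm_of_nonneg (by positivity)]
      refine mul_le_mul (han n) (div_le_self hK ?_) (by positivity) (by positivity)
      rw [hΛ, abs_neg]
      exact le_trans (by linarith) (le_abs_self _)
    · intro n
      by_cases hn : ArithmeticFunction.moebius n = 0
      · simp [ha, hn]
      · exact (tendsto_integral_exp_div two_pos (hΛ0 n hn)).const_mul _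
    · filter_upwards [(eventually_ge_atTop (0 : ℝ)).prod_mk (eventually_ge_atTop (0 : ℝ))]
        with p hp n
      by_cases hn : ArithmeticFunction.moebius n = 0
      · simp [ha, hn]
      · rw [norm_mul]
        exact mul_le_mul_of_nonneg_left (hKb _ (hΛ0 n hn) _ _ (by linarith [hp.1, hp.2]))
          (norm_nonneg _)
  simp_rw [hVP]
  refine hlim.trans (le_of_eq ?_)
  congr 1
  rw [tsum_eq_sum (s := Finset.Icc 1 ⌊Real.exp (-x)⌋₊), mertens, Int.cast_sum, Finset.mul_sum]
  · refine Finset.sum_congr rfl fun n hn => ?_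
    by_cases h0 : ArithmeticFunction.moebius n = 0
    · simp [ha, h0]
    obtain ⟨h1, h2⟩ := Finset.mem_Icc.1 hn
    have h3 : (n : ℝ) ≤ Real.exp (-x) := (Nat.le_floor_iff (Real.exp_pos _).le).1 h2
    have h4 : Real.log n ≤ -x := (Real.log_le_iff_le_exp (by positivity)).2 h3
    have h5 : 0 < Λ n := lt_of_le_of_ne (by simp only [hΛ]; linarith) (hΛ0 n h0).symm
    rw [if_pos h5, ha]
    -- The weight e^{2Λ n} in `a n` cancels the e^{-2Λ n} from Perron's formula, leaving 2πμ(n).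
    have : Complex.exp (2 * Λ n) * Complex.exp (-(2 : ℝ) * Λ n) = 1 := by
      rw [← Complex.exp_add]; simp
    linear_combination (2 * Real.pi * (ArithmeticFunction.moebius n : ℤ) : ℂ) * this
  · intro n hn
    rcases eq_or_ne n 0 with rfl | h0
    · simp [ha]
    rw [if_neg, mul_zero]
    rw [Finset.mem_Icc, not_and] at hn
    have h2 := hn (Nat.one_le_iff_ne_zero.2 h0)
    rw [Nat.le_floor_iff (Real.exp_pos _).le, not_le] at h2
    have h4 : -x < Real.log n := (Real.lt_log_iff_exp_lt (by positivity)).2 h2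
    simp only [hΛ]; linarith

/-! ### Moving the line of integration to Re s = σ. -/

theorem tendsto_integral_horizontal {f : ℂ → ℂ} {σ K : ℝ} (hσ : σ ≤ 2)
    (hf : ∀ s : ℂ, σ ≤ s.re → s.re ≤ 2 → ‖f s‖ ≤ K * (2 + |s.im|) ^ (-(3 / 4) : ℝ))
    {l : Filter ℝ} (hl : Tendsto (fun y : ℝ => |y|) l atTop) :
    Tendsto (fun y : ℝ => ∫ u in σ..2, f (u + y * Complex.I)) l (𝓝 0) := by
  have h1 : Tendsto (fun y : ℝ => K * (2 + |y|) ^ (-(3 / 4) : ℝ) * |2 - σ|) l (𝓝 0) := by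
    have h2 : Tendsto (fun y : ℝ => (2 + |y|)) l atTop := tendsto_atTop_add_const_left _ _ hl
    simpa using (((tendsto_rpow_neg_atTop (by norm_num : (0 : ℝ) < 3 / 4)).comp h2).const_mul
      K).mul_const |2 - σ|
  refine squeeze_zero_norm (fun y => ?_) h1
  refine intervalIntegral.norm_integral_le_of_norm_le_const fun u hu => ?_
  rw [Set.uIoc_of_le hσ] at hu
  simpa using hf (u + y * Complex.I) (by simpa using hu.1.le) (by simpa using hu.2)

/-- Moving a vertical line of integration to `Re s = 2`. -/
theorem tendsto_integral_vertical_shift {f : ℂ → ℂ} {σ K : ℝ} (hσ : σ ≤ 2)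
    (hd : DifferentiableOn ℂ f {s | σ ≤ s.re})
    (hf : ∀ s : ℂ, σ ≤ s.re → s.re ≤ 2 → ‖f s‖ ≤ K * (2 + |s.im|) ^ (-(3 / 4) : ℝ)) {J : ℂ}
    (hJ : Tendsto (fun p : ℝ × ℝ => ∫ y in (-p.1)..p.2, f (2 + Complex.I * y))
      (atTop ×ˢ atTop) (𝓝 J)) :
    Tendsto (fun p : ℝ × ℝ => ∫ y in (-p.1)..p.2, f (σ + Complex.I * y))
      (atTop ×ˢ atTop) (𝓝 J) := by
  have h1 := (tendsto_integral_horizontal hσ hf tendsto_abs_atTop_atTop).comp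
    (tendsto_snd : Tendsto Prod.snd (atTop ×ˢ atTop : Filter (ℝ × ℝ)) atTop)
  have h2 := (tendsto_integral_horizontal hσ hf tendsto_abs_atBot_atTop).comp
    (tendsto_neg_atTop_atBot.comp
      (tendsto_fst : Tendsto Prod.fst (atTop ×ˢ atTop : Filter (ℝ × ℝ)) atTop))
  have h3 := hJ.add ((h2.sub h1).div_const Complex.I)
  rw [sub_zero, zero_div, add_zero] at h3
  refine h3.congr fun p => ?_
  -- Cauchy's theorem on the rectangle with corners σ - i p.1 and 2 + i p.2; the horizontal sides
  -- tend to 0 separately, so the endpoints may move independently.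
  have h := Complex.integral_boundary_rect_eq_zero_of_differentiableOn f
    ((σ : ℂ) + ((-p.1 : ℝ) : ℂ) * Complex.I) (((2 : ℝ) : ℂ) + (p.2 : ℂ) * Complex.I) (hd.mono ?_)
  · simp only [Complex.add_re, Complex.add_im, Complex.mul_re, Complex.mul_im, Complex.ofReal_re,
      Complex.ofReal_im, Complex.I_re, Complex.I_im, mul_zero, mul_one, sub_zero,
      add_zero, zero_add, smul_eq_mul] at h
    have hc : ∀ c : ℂ, (fun y : ℝ => f (c + Complex.I * y)) = fun y : ℝ => f (c + y * Complex.I) :=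
      fun c => by ext y; rw [mul_comm]
    rw [hc, hc]
    simp only [Function.comp]
    have hI := Complex.I_ne_zero
    refine mul_left_cancel₀ hI ?_
    rw [mul_add, mul_div_cancel₀ _ hI]
    push_cast at h ⊢
    linear_combination h
  · intro s hs
    have := hs.1
    simp only [Complex.add_re, Complex.mul_re, Complex.ofReal_re, Complex.ofReal_im, Complex.I_re,
      Complex.I_im, mul_zero, mul_one, sub_zero, add_zero, Set.mem_preimage] at this
    rw [Set.uIcc_of_le hσ] at this
    exact this.1

theorem hasImproperIntegral_zetaSymbol (hRH : RiemannHypothesis) {σ : ℝ} (hσ : 1 / 2 < σ)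
    (hσ1 : σ < 1) {x : ℝ} (hx : ∀ n : ℕ, Squarefree n → x ≠ -Real.log n) :
    HasImproperIntegral (fun y : ℝ => Complex.exp (-Complex.I * x * y) * zetaSymbol σ y)
      (2 * Real.pi * (Real.exp (σ * x) : ℝ) * (mertens (Real.exp (-x)) : ℤ)) := by
  refine ⟨fun A B => Continuous.intervalIntegrable (Continuous.mul (by fun_prop)
    (memLp_zetaSymbol hRH hσ hσ1).1) _ _, ?_⟩
  obtain ⟨C, hC, hCs⟩ := exists_norm_recipMulZeta_le hRH hσ hσ1
  have h := tendsto_integral_vertical_shift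
    (f := fun s => Complex.exp (-x * s) * recipMulZeta s) (σ := σ)
    (K := Real.exp (2 * |x|) * C) (by linarith)
    (DifferentiableOn.mul (by fun_prop) ((differentiableOn_recipMulZeta hRH).mono
      fun s hs => hσ.trans_le hs)) (fun s hs hs2 => ?_) (tendsto_integral_recipMulZeta_two hx)
  -- The factor e^{σx} turns e^{-xs} into e^{-ixy} on Re s = σ.
  · have h2 := h.const_mul ((Real.exp (σ * x) : ℝ) : ℂ)
    rw [show 2 * Real.pi * (Real.exp (σ * x) : ℝ) * (mertens (Real.exp (-x)) : ℤ) =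
      ((Real.exp (σ * x) : ℝ) : ℂ) * (2 * Real.pi * (mertens (Real.exp (-x)) : ℤ)) by ring]
    refine h2.congr fun p => ?_
    rw [← intervalIntegral.integral_const_mul]
    congr 1
    ext y
    beta_reduce
    rw [zetaSymbol_eq_recipMulZeta hσ1.ne, ← mul_assoc, Complex.ofReal_exp, ← Complex.exp_add]
    congr 2
    push_cast; ring
  · rw [norm_mul, mul_assoc]
    refine mul_le_mul ?_ (hCs s hs hs2) (norm_nonneg _) (by positivity)
    rw [Complex.norm_exp]
    refine Real.exp_le_exp.2 ?_
    have : (-(x : ℂ) * s).re = -x * s.re := by simp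
    rw [this]
    have h1 : -x * s.re ≤ |x| * s.re :=
      mul_le_mul_of_nonneg_right (neg_le_abs x) (by linarith)
    nlinarith [abs_nonneg x]

/-! ### Fourier transforms on L¹ and L². -/

theorem integral_fourier_schwartz_mul_eq {f : ℝ → ℂ} (hf : Integrable f) (g : SchwartzMap ℝ ℂ) :
    ∫ x, FourierTransform.fourier g x • f x = ∫ x, g x • FourierTransform.fourier f x := by
  rw [SchwartzMap.fourier_coe]
  have h := VectorFourier.integral_fourierIntegral_smul_eq_flip (L := innerₗ ℝ)
    Real.continuous_fourierChar continuous_inner (g.integrable (μ := volume)) hf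
  rw [flip_innerₗ] at h
  exact h

theorem ae_eq_zero_of_forall_integral_schwartz_smul_eq_zero {f : ℝ → ℂ}
    (hf : LocallyIntegrable f) (h : ∀ g : SchwartzMap ℝ ℂ, ∫ x, g x • f x = 0) :
    ∀ᵐ x, f x = 0 := by
  refine ae_eq_zero_of_integral_contDiff_smul_eq_zero hf fun g hg hc => ?_
  have hc' : HasCompactSupport (Complex.ofRealCLM ∘ g) := hc.comp_left rfl
  have hg' : ContDiff ℝ (⊤ : ℕ∞) (Complex.ofRealCLM ∘ g) := by fun_prop
  simpa using h (hc'.toSchwartzMap hg')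

/-- The Fourier transform is injective on integrable functions. -/
theorem ae_eq_zero_of_fourier_eq_zero {f : ℝ → ℂ} (hf : Integrable f)
    (h : ∀ x, FourierTransform.fourier f x = 0) : ∀ᵐ x, f x = 0 := by
  refine ae_eq_zero_of_forall_integral_schwartz_smul_eq_zero hf.locallyIntegrable fun g => ?_
  have h1 := integral_fourier_schwartz_mul_eq hf (FourierTransform.fourierInv g)
  rw [FourierTransform.fourier_fourierInv_eq] at h1
  rw [h1]; simp [h]

/-- The Fourier transform of `L²` and the Fourier integral agree on integrable functions. -/
theorem coeFn_fourier_toLp_ae_eq {f : ℝ → ℂ} (hf : Integrable f) (hf2 : MemLp f 2) :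
    (FourierTransform.fourier (hf2.toLp f) : Lp (α := ℝ) ℂ 2) =ᵐ[volume]
      FourierTransform.fourier f := by
  set F : Lp (α := ℝ) ℂ 2 := FourierTransform.fourier (hf2.toLp f) with hF
  have hFl : LocallyIntegrable F := (Lp.memLp F).locallyIntegrable (by norm_num)
  have hcont : Continuous (FourierTransform.fourier f) :=
    VectorFourier.fourierIntegral_continuous Real.continuous_fourierChar continuous_inner hf
  have key : ∀ᵐ x, (F - FourierTransform.fourier f : ℝ → ℂ) x = 0 := by
    refine ae_eq_zero_of_forall_integral_schwartz_smul_eq_zero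
      (hFl.sub hcont.locallyIntegrable) fun g => ?_
    -- Both transforms move onto the Schwartz function g: one as a tempered distribution, the other
    -- by Fubini.
    have h1 : ∫ x, g x • F x = ∫ x, g x • FourierTransform.fourier f x := by
      have h2 := congrArg (fun T => T g) (Lp.fourier_toTemperedDistribution_eq (hf2.toLp f))
      simp only [TemperedDistribution.fourier_apply, Lp.toTemperedDistribution_apply] at h2
      rw [hF, ← h2, ← integral_fourier_schwartz_mul_eq hf]
      refine integral_congr_ae ?_
      filter_upwards [hf2.coeFn_toLp] with x hx
      rw [hx]
    have hi1 : Integrable fun x => g x • F x := by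
      have := (Lp.memLp F).integrable_mul (g.memLp 2)
      exact this.congr (ae_of_all _ fun x => mul_comm _ _)
    have hi2 : Integrable fun x => g x • FourierTransform.fourier f x := by
      refine (g.integrable (μ := volume)).mul_bdd (c := ∫ v, ‖f v‖) hcont.aestronglyMeasurable
        (ae_of_all _ fun x => ?_)
      exact VectorFourier.norm_fourierIntegral_le_integral_norm _ _ _ _ _
    simp only [Pi.sub_apply, smul_sub]
    rw [integral_sub hi1 hi2, h1, sub_self]
  filter_upwards [key] with x hx
  exact sub_eq_zero.1 hx

theorem eLpNorm_fourier_eq {f : ℝ → ℂ} (hf : Integrable f) (hf2 : MemLp f 2) :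
    eLpNorm (FourierTransform.fourier f) 2 volume = eLpNorm f 2 volume := by
  rw [← eLpNorm_congr_ae (coeFn_fourier_toLp_ae_eq hf hf2), ← eLpNorm_congr_ae hf2.coeFn_toLp,
    ← Lp.enorm_def, ← Lp.enorm_def, ← ofReal_norm, ← ofReal_norm,
    Lp.norm_fourier_eq]

/-- If the symmetric partial Fourier integrals of `f ∈ L²` converge almost everywhere, then the
limit is in `L²`. -/
theorem memLp_of_tendsto_partial_fourier {f φ : ℝ → ℂ} (hfc : Continuous f) (hf : MemLp f 2)
    (hφ : AEStronglyMeasurable φ)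
    (h : ∀ᵐ x : ℝ, Tendsto (fun p : ℝ × ℝ => ∫ y in (-p.1)..p.2,
      Complex.exp (-Complex.I * (2 * Real.pi * x : ℝ) * y) * f y) (atTop ×ˢ atTop) (𝓝 (φ x))) :
    MemLp φ 2 := by
  set F : ℕ → ℝ → ℂ := fun n => Set.indicator (Set.Ioc (-n : ℝ) n) f with hF
  have hFi : ∀ n, Integrable (F n) := fun n => by
    rw [hF, integrable_indicator_iff measurableSet_Ioc]
    exact (hfc.integrableOn_Icc).mono_set Set.Ioc_subset_Icc_self
  have hF2 : ∀ n, MemLp (F n) 2 := fun n => hf.indicator measurableSet_Ioc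
  have hcont : ∀ n, Continuous (FourierTransform.fourier (F n)) := fun n =>
    VectorFourier.fourierIntegral_continuous Real.continuous_fourierChar continuous_inner (hFi n)
  have hlim : ∀ᵐ x, Tendsto (fun n => FourierTransform.fourier (F n) x) atTop (𝓝 (φ x)) := by
    filter_upwards [h] with x hx
    have hn : Tendsto (fun n : ℕ => ((n : ℝ), (n : ℝ))) atTop (atTop ×ˢ atTop) :=
      tendsto_natCast_atTop_atTop.prodMk tendsto_natCast_atTop_atTop
    refine (hx.comp hn).congr fun n => ?_
    rw [Function.comp, Real.fourier_real_eq_integral_exp_smul,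
      intervalIntegral.integral_of_le (by linarith [n.cast_nonneg (α := ℝ)]),
      ← integral_indicator measurableSet_Ioc]
    congr 1
    ext y
    by_cases hy : y ∈ Set.Ioc (-n : ℝ) n
    · rw [Set.indicator_of_mem hy, hF]
      simp only [Set.indicator_of_mem hy, smul_eq_mul]
      congr 2
      push_cast; ring
    · rw [Set.indicator_of_notMem hy, hF]
      simp only [Set.indicator_of_notMem hy, smul_zero]
  -- Fatou's lemma: by Plancherel each truncated transform has L² norm at most that of f.
  have hle := Lp.eLpNorm_lim_le_liminf_eLpNorm (p := 2) (μ := volume)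
    (fun n => (hcont n).aestronglyMeasurable) φ hlim
  refine ⟨hφ, (hle.trans ?_).trans_lt hf.2⟩
  refine (liminf_le_liminf (v := fun _ => eLpNorm f 2 volume)
    (Eventually.of_forall fun n => ?_)).trans (by simp)
  rw [eLpNorm_fourier_eq (hFi n) (hF2 n)]
  exact eLpNorm_indicator_le f

/-! ### Square integrability of the solution. -/

/-- The solution `-e^{σx} M(e^{-x})`. -/
noncomputable def salemSolution (σ x : ℝ) : ℂ :=
  -((Real.exp (σ * x) : ℝ) : ℂ) * ((mertens (Real.exp (-x)) : ℤ) : ℂ)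

theorem measurable_mertens : Measurable mertens := by
  have : mertens = (fun n : ℕ => ∑ k ∈ Finset.Icc 1 n, ArithmeticFunction.moebius k) ∘
      fun x : ℝ => ⌊x⌋₊ := rfl
  rw [this]
  exact measurable_from_nat.comp Nat.measurable_floor

theorem measurable_salemSolution (σ : ℝ) : Measurable (salemSolution σ) := by
  have h : Measurable fun x : ℝ => ((mertens (Real.exp (-x)) : ℤ) : ℂ) :=
    (measurable_from_top (f := fun n : ℤ => (n : ℂ))).comp
      (measurable_mertens.comp (by fun_prop))
  unfold salemSolution
  exact Measurable.mul (by fun_prop) h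

theorem salemSolution_of_pos (σ : ℝ) {x : ℝ} (hx : 0 < x) : salemSolution σ x = 0 := by
  have : ⌊Real.exp (-x)⌋₊ = 0 := Nat.floor_eq_zero.2 (Real.exp_lt_one_iff.2 (by linarith))
  simp [salemSolution, mertens, this]

/-- No pointwise bound on M is used: off a countable set the solution is a limit of partial Fourier
integrals of the L² function `zetaSymbol σ`. The dilation by 2π only matches Fourier conventions. -/
theorem memLp_salemSolution (hRH : RiemannHypothesis) {σ : ℝ} (hσ : 1 / 2 < σ) (hσ1 : σ < 1) :
    MemLp (salemSolution σ) 2 := by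
  obtain ⟨hc, hz⟩ := memLp_zetaSymbol hRH hσ hσ1
  have h2pi : (2 * Real.pi) ≠ 0 := by positivity
  have h := memLp_of_tendsto_partial_fourier hc hz
    (φ := fun x => -(2 * Real.pi) * salemSolution σ (2 * Real.pi * x))
    ((((measurable_salemSolution σ).comp (measurable_const_mul _)).const_mul _).aestronglyMeasurable)
    (by
      have hcount : (Set.range fun n : ℕ => -Real.log n / (2 * Real.pi)).Countable :=
        Set.countable_range _
      filter_upwards [hcount.ae_notMem volume] with x hx
      have := (hasImproperIntegral_zetaSymbol hRH hσ hσ1 (x := 2 * Real.pi * x) (fun n _ hn =>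
        hx ⟨n, by simp only [← hn]; field_simp⟩)).2
      convert this using 2
      rw [salemSolution]; ring)
  have h3 : MemLp (fun x => salemSolution σ (2 * Real.pi * x)) 2 := by
    have := h.const_mul ((-(2 * Real.pi) : ℂ)⁻¹)
    refine this.ae_eq (ae_of_all _ fun x => ?_)
    have : (-(2 * Real.pi) : ℂ) ≠ 0 := by
      have : (Real.pi : ℂ) ≠ 0 := by exact_mod_cast Real.pi_ne_zero
      simp
    simp only [inv_mul_cancel_left₀ this]
  rw [memLp_two_iff_integrable_sq_norm h3.1] at h3
  rw [memLp_two_iff_integrable_sq_norm (measurable_salemSolution σ).aestronglyMeasurable]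
  exact (integrable_comp_mul_left_iff (fun x => ‖salemSolution σ x‖ ^ 2) h2pi).1 h3

/-! ### Möbius inversion and the integral equation. -/

theorem summable_pnat_pow {r : ℝ} (hr0 : 0 ≤ r) (hr : r < 1) : Summable fun n : ℕ+ => r ^ (n : ℕ) :=
  (summable_geometric_of_lt_one hr0 hr).comp_injective PNat.coe_injective

/-- Möbius inversion for series with geometric decay. -/
theorem tsum_moebius_mul_tsum_eq {f : ℕ → ℝ} {C r : ℝ} (hr0 : 0 < r) (hr : r < 1)
    (hf : ∀ m : ℕ, 1 ≤ m → |f m| ≤ C * r ^ m) :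
    ∑' n : ℕ+, (ArithmeticFunction.moebius n : ℝ) * ∑' k : ℕ+, f (n * k) = f 1 := by
  have hC : 0 ≤ C := by
    have h := (abs_nonneg _).trans (hf 1 le_rfl)
    rw [pow_one] at h
    exact nonneg_of_mul_nonneg_left h hr0
  -- Since n + k ≤ 2nk, r^{nk} ≤ s^n s^k with s = √r, so the double series is dominated by a product
  -- of geometric series.
  set s : ℝ := Real.sqrt r with hs
  have hs0 : 0 ≤ s := Real.sqrt_nonneg r
  have hs1 : s < 1 := by rw [hs, Real.sqrt_lt' one_pos]; simpa
  have hss : s ^ 2 = r := Real.sq_sqrt hr0.le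
  have hsum : Summable fun p : ℕ+ × ℕ+ =>
      (ArithmeticFunction.moebius p.1 : ℝ) * f (p.1 * p.2) := by
    have hg := (((summable_pnat_pow hs0 hs1).mul_of_nonneg (summable_pnat_pow hs0 hs1)
      (fun _ => by positivity) (fun _ => by positivity)).mul_left C)
    refine Summable.of_norm_bounded hg fun p => ?_
    have h1 : |(ArithmeticFunction.moebius p.1 : ℝ)| ≤ 1 := by
      exact_mod_cast ArithmeticFunction.abs_moebius_le_one
    have hp1 := p.1.pos
    have hp2 := p.2.pos
    rw [Real.norm_eq_abs, abs_mul]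
    refine (mul_le_of_le_one_left (abs_nonneg _) h1).trans ((hf _ (Nat.mul_pos hp1 hp2)).trans ?_)
    refine mul_le_mul_of_nonneg_left ?_ hC
    rw [← pow_add, ← hss, ← pow_mul]
    refine pow_le_pow_of_le_one hs0 hs1.le ?_
    nlinarith
  calc ∑' n : ℕ+, (ArithmeticFunction.moebius n : ℝ) * ∑' k : ℕ+, f (n * k)
      = ∑' n : ℕ+, ∑' k : ℕ+, (ArithmeticFunction.moebius n : ℝ) * f (n * k) :=
        tsum_congr fun n => tsum_mul_left.symm
    _ = ∑' p : ℕ+ × ℕ+, (ArithmeticFunction.moebius p.1 : ℝ) * f (p.1 * p.2) :=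
        (hsum.tsum_prod).symm
    _ = ∑' q : Σ n : ℕ+, Nat.divisorsAntidiagonal n,
          (ArithmeticFunction.moebius (sigmaAntidiagonalEquivProd q).1 : ℝ) *
            f ((sigmaAntidiagonalEquivProd q).1 * (sigmaAntidiagonalEquivProd q).2) :=
        (sigmaAntidiagonalEquivProd.tsum_eq (fun p : ℕ+ × ℕ+ =>
          (ArithmeticFunction.moebius p.1 : ℝ) * f (p.1 * p.2))).symm
    -- Grouping by m = nk leaves f(m) times the sum of μ over the divisors of m, zero unless m = 1.
    _ = ∑' m : ℕ+, if m = 1 then f 1 else 0 := by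
        refine ((sigmaAntidiagonalEquivProd.summable_iff.2 hsum).tsum_sigma).trans
          (tsum_congr fun m => ?_)
        have h1 : ∀ c : Nat.divisorsAntidiagonal m,
            (ArithmeticFunction.moebius (sigmaAntidiagonalEquivProd ⟨m, c⟩).1 : ℝ) *
            f ((sigmaAntidiagonalEquivProd ⟨m, c⟩).1 * (sigmaAntidiagonalEquivProd ⟨m, c⟩).2) =
            (fun x : ℕ × ℕ => (ArithmeticFunction.moebius x.1 : ℝ) * f m) c := by
          intro c
          have hc := (Nat.mem_divisorsAntidiagonal.1 c.2).1
          show (ArithmeticFunction.moebius c.1.1 : ℝ) * f (c.1.1 * c.1.2) = _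
          rw [hc]
        refine ((tsum_congr h1).trans (Finset.tsum_subtype _
          (fun x : ℕ × ℕ => (ArithmeticFunction.moebius x.1 : ℝ) * f m))).trans ?_
        rw [← Finset.sum_mul]
        have h2 := congrArg (fun F : ArithmeticFunction ℝ => F m)
          (ArithmeticFunction.coe_moebius_mul_coe_zeta (R := ℝ))
        simp only [ArithmeticFunction.mul_apply, ArithmeticFunction.one_apply] at h2
        have h3 : ∑ x ∈ (m : ℕ).divisorsAntidiagonal, (ArithmeticFunction.moebius x.1 : ℝ) =
            if (m : ℕ) = 1 then 1 else 0 := by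
          rw [← h2]
          refine Finset.sum_congr rfl fun x hx => ?_
          have := Nat.ne_zero_of_mem_divisorsAntidiagonal hx
          simp [this.2]
        rw [h3]
        by_cases hm : m = 1
        · simp [hm]
        · simp [hm]
    _ = f 1 := tsum_ite_eq _ _

/-- The exponential integral `E₁(z) = ∫_z^∞ e^{-v} / v dv`, in the variable `v = z e^{-y}`. -/
noncomputable def expIntegralE (z : ℝ) : ℝ := ∫ y in Set.Iic (0 : ℝ), Real.exp (-z * Real.exp (-y))

theorem exp_neg_mul_exp_neg_le {z : ℝ} (hz : 0 ≤ z) (y : ℝ) :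
    Real.exp (-z * Real.exp (-y)) ≤ Real.exp (-z) * Real.exp (z * y) := by
  rw [← Real.exp_add]
  refine Real.exp_le_exp.2 ?_
  have := Real.add_one_le_exp (-y)
  nlinarith

theorem integrableOn_exp_neg_mul_exp {z : ℝ} (hz : 0 < z) :
    IntegrableOn (fun y => Real.exp (-z * Real.exp (-y))) (Set.Iic 0) := by
  refine Integrable.mono' ((integrableOn_exp_mul_Iic hz 0).const_mul (Real.exp (-z)))
    (by fun_prop) (ae_of_all _ fun y => ?_)
  rw [Real.norm_of_nonneg (Real.exp_pos _).le]
  exact exp_neg_mul_exp_neg_le hz.le y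

theorem expIntegralE_nonneg (z : ℝ) : 0 ≤ expIntegralE z :=
  integral_nonneg fun _ => (Real.exp_pos _).le

theorem expIntegralE_le {z : ℝ} (hz : 0 < z) : expIntegralE z ≤ Real.exp (-z) / z := by
  have h := integral_mono (integrableOn_exp_neg_mul_exp hz)
    ((integrableOn_exp_mul_Iic hz 0).const_mul (Real.exp (-z)))
    fun y => exp_neg_mul_exp_neg_le hz.le y
  rwa [integral_const_mul, integral_exp_mul_Iic hz, mul_zero, Real.exp_zero, mul_one_div] at h

theorem Ei_neg {z : ℝ} (hz : 0 < z) : Ei (-z) = -expIntegralE z := by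
  have himg : (fun y : ℝ => -z * Real.exp (-y)) '' Set.Iic 0 = Set.Iic (-z) := by
    ext t
    constructor
    · rintro ⟨y, hy, rfl⟩
      have hy : y ≤ 0 := hy
      have : 1 ≤ Real.exp (-y) := Real.one_le_exp (by linarith)
      show -z * Real.exp (-y) ≤ -z
      nlinarith
    · intro ht
      have ht : t ≤ -z := ht
      have h1 : 1 ≤ -t / z := by rw [le_div_iff₀ hz]; linarith
      refine ⟨-Real.log (-t / z), ?_, ?_⟩
      · have := Real.log_nonneg h1
        show -Real.log (-t / z) ≤ 0
        linarith
      · show -z * Real.exp (- -Real.log (-t / z)) = t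
        rw [neg_neg, Real.exp_log (by linarith)]; field_simp
  have h := integral_image_eq_integral_abs_deriv_smul (s := Set.Iic (0 : ℝ))
    (f := fun y => -z * Real.exp (-y)) (f' := fun y => z * Real.exp (-y)) measurableSet_Iic
    (fun y _ => by
      have h1 : HasDerivAt (fun y : ℝ => -z * Real.exp (-y)) (-z * (Real.exp (-y) * -1)) y :=
        ((hasDerivAt_neg y).exp).const_mul (-z)
      exact (h1.congr_deriv (by ring)).hasDerivWithinAt)
    (fun a _ b _ hab => by
      have h1 : Real.exp (-a) = Real.exp (-b) := mul_left_cancel₀ (neg_ne_zero.2 hz.ne') hab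
      exact neg_injective (Real.exp_injective h1))
    (fun t => Real.exp t / t)
  rw [himg] at h
  rw [Ei, h, expIntegralE, ← integral_neg]
  congr 1
  ext y
  have := Real.exp_pos (-y)
  rw [smul_eq_mul, abs_of_pos (by positivity)]
  field_simp

/-- `∫_z^∞ dv / (v (e^v + 1))`, in the variable `v = z e^{-y}`. -/
noncomputable def fermiTail (z : ℝ) : ℝ :=
  ∫ y in Set.Iic (0 : ℝ), (Real.exp (z * Real.exp (-y)) + 1)⁻¹

theorem inv_exp_add_one_le (v : ℝ) : (Real.exp v + 1)⁻¹ ≤ Real.exp (-v) := by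
  rw [Real.exp_neg]
  exact inv_anti₀ (Real.exp_pos v) (by linarith)

theorem hasSum_exp_neg_pnat {v : ℝ} (hv : 0 < v) :
    HasSum (fun k : ℕ+ => Real.exp (-(k * v))) ((Real.exp v - 1)⁻¹) := by
  have h1 : Real.exp (-v) < 1 := Real.exp_lt_one_iff.2 (by linarith)
  have h := (hasSum_geometric_of_lt_one (Real.exp_pos (-v)).le h1).mul_left (Real.exp (-v))
  have h2 : Real.exp (-v) * (1 - Real.exp (-v))⁻¹ = (Real.exp v - 1)⁻¹ := by
    have h3 : 1 < Real.exp v := Real.one_lt_exp_iff.2 hv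
    rw [Real.exp_neg]
    have : Real.exp v - 1 ≠ 0 := by linarith
    field_simp
  rw [h2] at h
  rw [← Equiv.pnatEquivNat.symm.hasSum_iff]
  refine h.congr_fun ?_ |> id
  intro n
  simp only [Function.comp, Equiv.pnatEquivNat_symm_apply, Nat.succPNat_coe]
  rw [← Real.exp_nat_mul, ← Real.exp_add]
  congr 1
  push_cast; ring

/-- Uses 1/(e^v+1) = 1/(e^v-1) - 2/(e^{2v}-1). Compared with the alternating geometric series, this
grouping reproduces the shape E₁(z) - 2E₁(2z) of the datum. -/
theorem hasSum_inv_exp_add_one {v : ℝ} (hv : 0 < v) :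
    HasSum (fun k : ℕ+ => Real.exp (-(k * v)) - 2 * Real.exp (-(k * (2 * v))))
      ((Real.exp v + 1)⁻¹) := by
  have h := (hasSum_exp_neg_pnat hv).sub ((hasSum_exp_neg_pnat (v := 2 * v) (by linarith)).mul_left 2)
  have h3 : 1 < Real.exp v := Real.one_lt_exp_iff.2 hv
  have h4 : (Real.exp v - 1)⁻¹ - 2 * (Real.exp (2 * v) - 1)⁻¹ = (Real.exp v + 1)⁻¹ := by
    have h5 : Real.exp (2 * v) - 1 = (Real.exp v - 1) * (Real.exp v + 1) := by
      rw [two_mul, Real.exp_add]; ring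
    have h6 : Real.exp v - 1 ≠ 0 := by linarith
    have h7 : Real.exp v + 1 ≠ 0 := by linarith
    rw [h5]; field_simp; ring
  rwa [h4] at h

theorem expIntegralE_pnat_mul_le {z : ℝ} (hz : 0 < z) (k : ℕ) (hk : 1 ≤ k) :
    expIntegralE (k * z) ≤ z⁻¹ * Real.exp (-z) ^ k := by
  have hk' : (1 : ℝ) ≤ k := by exact_mod_cast hk
  refine (expIntegralE_le (by positivity)).trans ?_
  rw [← Real.exp_nat_mul, div_eq_inv_mul, mul_neg]
  gcongr
  nlinarith

theorem summable_expIntegralE {z : ℝ} (hz : 0 < z) :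
    Summable fun k : ℕ+ => expIntegralE (k * z) := by
  refine Summable.of_nonneg_of_le (fun k => expIntegralE_nonneg _)
    (fun k => expIntegralE_pnat_mul_le hz k k.pos) ((summable_pnat_pow (Real.exp_pos _).le
      (Real.exp_lt_one_iff.2 (by linarith))).mul_left _)

theorem fermiTail_eq_tsum {z : ℝ} (hz : 0 < z) :
    fermiTail z = ∑' k : ℕ+, (expIntegralE (k * z) - 2 * expIntegralE (2 * (k * z))) := by
  have hi : ∀ k : ℕ+, IntegrableOn (fun y => Real.exp (-(k * z) * Real.exp (-y))) (Set.Iic 0) :=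
    fun k => integrableOn_exp_neg_mul_exp (by positivity)
  have hi2 : ∀ k : ℕ+, IntegrableOn (fun y => Real.exp (-(2 * (k * z)) * Real.exp (-y)))
    (Set.Iic 0) := fun k => integrableOn_exp_neg_mul_exp (by positivity)
  have hF : ∀ k : ℕ+, Integrable (fun y => Real.exp (-(k * z) * Real.exp (-y)) -
      2 * Real.exp (-(2 * (k * z)) * Real.exp (-y))) (volume.restrict (Set.Iic 0)) :=
    fun k => (hi k).sub ((hi2 k).const_mul 2)
  have h := hasSum_integral_of_summable_integral_norm hF ?_
  · rw [fermiTail]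
    have h2 : ∀ k : ℕ+, ∫ y in Set.Iic (0 : ℝ), (Real.exp (-(k * z) * Real.exp (-y)) -
      2 * Real.exp (-(2 * (k * z)) * Real.exp (-y))) =
        expIntegralE (k * z) - 2 * expIntegralE (2 * (k * z)) := by
      intro k
      rw [integral_sub (hi k) ((hi2 k).const_mul 2), integral_const_mul]
      rfl
    simp_rw [h2] at h
    rw [h.tsum_eq]
    congr 1
    ext y
    rw [← (hasSum_inv_exp_add_one (v := z * Real.exp (-y)) (by positivity)).tsum_eq]
    refine tsum_congr fun k => ?_
    congr 3 <;> ring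
  · have hs2 := summable_expIntegralE (z := 2 * z) (by positivity)
    refine Summable.of_nonneg_of_le (fun k => integral_nonneg fun _ => norm_nonneg _) (fun k => ?_)
      ((summable_expIntegralE hz).add (hs2.mul_left 2))
    have h3 : expIntegralE (k * z) + 2 * expIntegralE (k * (2 * z)) =
        ∫ y in Set.Iic (0 : ℝ), (Real.exp (-(k * z) * Real.exp (-y)) +
          2 * Real.exp (-(2 * (k * z)) * Real.exp (-y))) := by
      rw [integral_add (hi k) ((hi2 k).const_mul 2), integral_const_mul,
        show (k : ℝ) * (2 * z) = 2 * (k * z) by ring]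
      rfl
    rw [h3]
    refine integral_mono (hF k).norm ((hi k).add ((hi2 k).const_mul 2)) fun y => ?_
    refine (norm_sub_le _ _).trans ?_
    rw [Real.norm_of_nonneg (Real.exp_pos _).le, Real.norm_of_nonneg (by positivity)]

/-- Möbius inversion for f(m) = E₁(mz) - 2E₁(2mz), as Σ_k f(nk) is the Fermi tail at nz. The
constant 3/z is 1/z for the first term plus a bound 2/z for the second. -/
theorem tsum_moebius_mul_fermiTail {z : ℝ} (hz : 0 < z) :
    ∑' n : ℕ+, (ArithmeticFunction.moebius n : ℝ) * fermiTail (n * z) =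
      expIntegralE z - 2 * expIntegralE (2 * z) := by
  have h := tsum_moebius_mul_tsum_eq
    (f := fun m => expIntegralE (m * z) - 2 * expIntegralE (2 * (m * z))) (r := Real.exp (-z))
    (C := 3 * z⁻¹) (Real.exp_pos _) (Real.exp_lt_one_iff.2 (by linarith)) (fun m hm => ?_)
  · rw [Nat.cast_one, one_mul] at h
    rw [← h]
    refine tsum_congr fun n => ?_
    rw [fermiTail_eq_tsum (by positivity)]
    congr 1
    refine tsum_congr fun k => ?_
    rw [Nat.cast_mul, mul_left_comm, ← mul_assoc]
  · have h1 := expIntegralE_pnat_mul_le hz m hm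
    have h2 := expIntegralE_pnat_mul_le (z := 2 * z) (by positivity) m hm
    rw [show (m : ℝ) * (2 * z) = 2 * (m * z) by ring] at h2
    have h3 : (2 * z)⁻¹ * Real.exp (-(2 * z)) ^ m ≤ z⁻¹ * Real.exp (-z) ^ m := by
      gcongr <;> linarith
    have h4 := expIntegralE_nonneg (m * z)
    have h5 := expIntegralE_nonneg (2 * (m * z))
    rw [abs_le]
    constructor <;> linarith

theorem abs_mertens_le {u : ℝ} (hu : 0 ≤ u) : |(mertens u : ℝ)| ≤ u := by
  have h : |mertens u| ≤ (⌊u⌋₊ : ℤ) := by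
    refine (Finset.abs_sum_le_sum_abs _ _).trans ?_
    refine (Finset.sum_le_sum fun n _ => ArithmeticFunction.abs_moebius_le_one).trans ?_
    simp
  calc |(mertens u : ℝ)| ≤ (⌊u⌋₊ : ℝ) := by exact_mod_cast h
    _ ≤ u := Nat.floor_le hu

theorem mertens_mul_eq_tsum (y c : ℝ) :
    (mertens (Real.exp (-y)) : ℝ) * c = ∑' n : ℕ, (ArithmeticFunction.moebius n : ℝ) *
      Set.indicator (Set.Iic (-Real.log n)) (fun _ => c) y := by
  rw [tsum_eq_sum (s := Finset.Icc 1 ⌊Real.exp (-y)⌋₊), mertens, Int.cast_sum, Finset.sum_mul]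
  · refine Finset.sum_congr rfl fun n hn => ?_
    obtain ⟨h1, h2⟩ := Finset.mem_Icc.1 hn
    have h3 : (n : ℝ) ≤ Real.exp (-y) := (Nat.le_floor_iff (Real.exp_pos _).le).1 h2
    have h4 : Real.log n ≤ -y := (Real.log_le_iff_le_exp (by positivity)).2 h3
    rw [Set.indicator_of_mem (Set.mem_Iic.2 (by linarith))]
  · intro n hn
    rcases eq_or_ne n 0 with rfl | h0
    · simp
    rw [Finset.mem_Icc, not_and] at hn
    have h2 := hn (Nat.one_le_iff_ne_zero.2 h0)
    rw [Nat.le_floor_iff (Real.exp_pos _).le, not_le] at h2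
    have h4 : -y < Real.log n := (Real.lt_log_iff_exp_lt (by positivity)).2 h2
    rw [Set.indicator_of_notMem (by rw [Set.mem_Iic]; linarith), mul_zero]

theorem mertens_exp_neg_of_pos {y : ℝ} (hy : 0 < y) : mertens (Real.exp (-y)) = 0 := by
  have : ⌊Real.exp (-y)⌋₊ = 0 := Nat.floor_eq_zero.2 (Real.exp_lt_one_iff.2 (by linarith))
  simp [mertens, this]

/-- The trivial bound |M(w)| ≤ w at w = e^{-y} is enough, since the kernel is at most e^{-Xw} and
M(e^{-y}) = 0 for y > 0. -/
theorem integrable_mertens_mul {X : ℝ} (hX : 0 < X) :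
    Integrable fun y => (mertens (Real.exp (-y)) : ℝ) * (Real.exp (X * Real.exp (-y)) + 1)⁻¹ := by
  have hg : Integrable (Set.indicator (Set.Iic 0) fun y : ℝ =>
      2 / X * Real.exp (-(X / 2) * Real.exp (-y))) := by
    rw [integrable_indicator_iff measurableSet_Iic]
    exact (integrableOn_exp_neg_mul_exp (by positivity)).const_mul _
  have hm : Measurable fun y : ℝ => (mertens (Real.exp (-y)) : ℝ) :=
    (measurable_from_top (f := fun n : ℤ => (n : ℝ))).comp
      (measurable_mertens.comp (by fun_prop))
  refine hg.mono' (hm.mul (by fun_prop)).aestronglyMeasurable (ae_of_all _ fun y => ?_)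
  by_cases hy : y ∈ Set.Iic (0 : ℝ)
  · rw [Set.indicator_of_mem hy, norm_mul, Real.norm_eq_abs, Real.norm_of_nonneg (by positivity)]
    set w := Real.exp (-y) with hw
    have hw0 : 0 < w := Real.exp_pos _
    have h1 := abs_mertens_le hw0.le
    have h2 := inv_exp_add_one_le (X * w)
    -- Half of the exponential absorbs the factor w; the other half stays as the majorant.
    have h3 : w * Real.exp (-(X / 2) * w) ≤ 2 / X := by
      rw [neg_mul, Real.exp_neg, ← div_eq_mul_inv, div_le_div_iff₀ (Real.exp_pos _) hX]
      have := Real.add_one_le_exp (X / 2 * w)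
      nlinarith
    have h4 : Real.exp (-(X * w)) = Real.exp (-(X / 2) * w) * Real.exp (-(X / 2) * w) := by
      rw [← Real.exp_add]; congr 1; ring
    calc _ ≤ w * Real.exp (-(X * w)) := by gcongr
      _ = (w * Real.exp (-(X / 2) * w)) * Real.exp (-(X / 2) * w) := by rw [h4]; ring
      _ ≤ _ := by gcongr
  · rw [mertens_exp_neg_of_pos (not_le.1 hy), Set.indicator_of_notMem hy]
    simp

theorem integrableOn_inv_exp_add_one {z : ℝ} (hz : 0 < z) :
    IntegrableOn (fun y : ℝ => (Real.exp (z * Real.exp (-y)) + 1)⁻¹) (Set.Iic 0) := by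
  refine Integrable.mono' (integrableOn_exp_neg_mul_exp hz)
    (Measurable.aestronglyMeasurable (by fun_prop)) (ae_of_all _ fun y => ?_)
  rw [Real.norm_of_nonneg (by positivity), neg_mul]
  exact inv_exp_add_one_le _

theorem fermiTail_le {z : ℝ} (hz : 0 < z) : fermiTail z ≤ expIntegralE z := by
  refine integral_mono (integrableOn_inv_exp_add_one hz) (integrableOn_exp_neg_mul_exp hz)
    fun y => ?_
  simp only [neg_mul]
  exact inv_exp_add_one_le _

theorem indicator_Iic_neg_log_eq {X : ℝ} {n : ℕ} (hn : n ≠ 0) :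
    Set.indicator (Set.Iic (-Real.log n)) (fun y : ℝ => (Real.exp (X * Real.exp (-y)) + 1)⁻¹) =
      fun y => Set.indicator (Set.Iic 0)
        (fun y : ℝ => (Real.exp (n * X * Real.exp (-y)) + 1)⁻¹) (y + Real.log n) := by
  ext y
  have hn' : (0 : ℝ) < n := by positivity
  by_cases hy : y ∈ Set.Iic (-Real.log n)
  · have hy' : y ≤ -Real.log n := hy
    rw [Set.indicator_of_mem hy, Set.indicator_of_mem (Set.mem_Iic.2 (by linarith))]
    rw [neg_add, Real.exp_add, Real.exp_neg (Real.log n), Real.exp_log hn']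
    congr 3
    field_simp
  · have hy' : ¬ y ≤ -Real.log n := hy
    rw [Set.indicator_of_notMem hy,
      Set.indicator_of_notMem (by rw [Set.mem_Iic]; linarith)]

/-- The translation y ↦ y + log n turns the n-th step of M into a Fermi tail at nX. These tails
decay geometrically in n, which justifies exchanging sum and integral. -/
theorem integral_mertens_mul {X : ℝ} (hX : 0 < X) :
    ∫ y, (mertens (Real.exp (-y)) : ℝ) * (Real.exp (X * Real.exp (-y)) + 1)⁻¹ =
      expIntegralE X - 2 * expIntegralE (2 * X) := by
  set G : ℕ → ℝ → ℝ := fun n => Set.indicator (Set.Iic (-Real.log n))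
    (fun y : ℝ => (Real.exp (X * Real.exp (-y)) + 1)⁻¹) with hG
  have hGi : ∀ n : ℕ, n ≠ 0 → Integrable (G n) := fun n hn => by
    simp only [hG]
    rw [indicator_Iic_neg_log_eq hn]
    refine Integrable.comp_add_right (f := Set.indicator (Set.Iic 0)
        (fun y : ℝ => (Real.exp (n * X * Real.exp (-y)) + 1)⁻¹)) ?_ (Real.log n)
    rw [integrable_indicator_iff measurableSet_Iic]
    exact integrableOn_inv_exp_add_one (by positivity)
  have hGint : ∀ n : ℕ, n ≠ 0 → ∫ y, G n y = fermiTail (n * X) := fun n hn => by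
    simp only [hG]
    rw [indicator_Iic_neg_log_eq hn, integral_add_right_eq_self (fun y => Set.indicator (Set.Iic 0)
        (fun y : ℝ => (Real.exp (n * X * Real.exp (-y)) + 1)⁻¹) y),
      integral_indicator measurableSet_Iic]
    rfl
  have hG0 : ∀ n y, 0 ≤ G n y := fun n y => Set.indicator_nonneg (fun _ _ => by positivity) _
  set F : ℕ → ℝ → ℝ := fun n y => (ArithmeticFunction.moebius n : ℝ) * G n y with hF
  have hFi : ∀ n, Integrable (F n) := fun n => by
    rcases eq_or_ne n 0 with rfl | hn
    · simp [hF]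
    · exact (hGi n hn).const_mul _
  have hFn : ∀ n, ∫ y, ‖F n y‖ ≤ X⁻¹ * Real.exp (-X) ^ n := fun n => by
    rcases eq_or_ne n 0 with rfl | hn
    · simp [hF]; positivity
    · have h1 : |(ArithmeticFunction.moebius n : ℝ)| ≤ 1 := by
        exact_mod_cast ArithmeticFunction.abs_moebius_le_one
      refine (integral_mono (hFi n).norm (hGi n hn) fun y => ?_).trans ?_
      · simp only [hF]
        rw [norm_mul, Real.norm_eq_abs, Real.norm_of_nonneg (hG0 n y)]
        exact mul_le_of_le_one_left (hG0 n y) h1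
      · rw [hGint n hn]
        exact (fermiTail_le (by positivity)).trans
          (expIntegralE_pnat_mul_le hX n (Nat.one_le_iff_ne_zero.2 hn))
  have h := hasSum_integral_of_summable_integral_norm hFi
    (Summable.of_nonneg_of_le (fun n => integral_nonneg fun _ => norm_nonneg _) hFn
      ((summable_geometric_of_lt_one (Real.exp_pos _).le
        (Real.exp_lt_one_iff.2 (by linarith))).mul_left _))
  have h2 : ∀ y, ∑' n, F n y =
      (mertens (Real.exp (-y)) : ℝ) * (Real.exp (X * Real.exp (-y)) + 1)⁻¹ := fun y => by
    rw [mertens_mul_eq_tsum]; rfl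
  simp_rw [h2] at h
  rw [← h.tsum_eq, ← tsum_moebius_mul_fermiTail hX]
  have h3 : ∀ n : ℕ, ∫ y, F n y = (ArithmeticFunction.moebius n : ℝ) * fermiTail (n * X) :=
    fun n => by
      rcases eq_or_ne n 0 with rfl | hn
      · simp [hF]
      · simp only [hF]
        rw [integral_const_mul, hGint n hn]
  simp_rw [h3]
  -- Passing from ℕ to ℕ+ loses nothing because μ(0) = 0.
  refine (PNat.coe_injective.tsum_eq (f := fun n : ℕ =>
    (ArithmeticFunction.moebius n : ℝ) * fermiTail (n * X)) ?_).symm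
  intro n hn
  have : n ≠ 0 := by rintro rfl; simp at hn
  exact ⟨⟨n, Nat.pos_of_ne_zero this⟩, rfl⟩

theorem salemIntegrand_salemSolution (σ x : ℝ) : salemIntegrand σ (salemSolution σ) x =
    fun y => ((-((mertens (Real.exp (-y)) : ℝ) *
      (Real.exp (Real.exp x * Real.exp (-y)) + 1)⁻¹) : ℝ) : ℂ) := by
  ext y
  have h1 : Real.exp (-σ * y) * Real.exp (σ * y) = 1 := by
    rw [← Real.exp_add]; simp
  have h1' : ((Real.exp (-σ * y) : ℝ) : ℂ) * ((Real.exp (σ * y) : ℝ) : ℂ) = 1 := by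
    exact_mod_cast h1
  rw [salemIntegrand, salemSolution, sub_eq_add_neg, Real.exp_add x]
  push_cast at h1' ⊢
  rw [div_eq_mul_inv]
  linear_combination (-(mertens (Real.exp (-y)) : ℂ) *
    (Complex.exp (Complex.exp x * Complex.exp (-y)) + 1)⁻¹) * h1'

/-- The weights e^{-σy} and e^{σy} cancel; the minus sign of the solution matches Ei(-z) = -E₁(z).
-/
theorem solvesSalemAt_salemSolution (σ x : ℝ) : SolvesSalemAt σ (salemSolution σ) x := by
  have hX : 0 < Real.exp x := Real.exp_pos x
  rw [SolvesSalemAt, salemIntegrand_salemSolution]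
  refine ⟨(integrable_mertens_mul hX).neg.ofReal, ?_⟩
  beta_reduce
  have h2 : Ei (-2 * Real.exp x) = -expIntegralE (2 * Real.exp x) := by
    rw [← Ei_neg (by positivity), neg_mul]
  rw [integral_complex_ofReal, integral_neg, integral_mertens_mul hX, salemDatum, Ei_neg hX, h2]
  push_cast; ring

/-! ### The Mellin transform of the Fermi function and its zeros. -/

/-- The Bose function `1/(e^v - 1)`. -/
noncomputable def boseFn (v : ℝ) : ℂ := (((Real.exp v - 1)⁻¹ : ℝ) : ℂ)

/-- The Fermi function `1/(e^v + 1)`. -/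
noncomputable def fermiFn (v : ℝ) : ℂ := (((Real.exp v + 1)⁻¹ : ℝ) : ℂ)

theorem continuous_fermiFn : Continuous fermiFn := by
  refine Complex.continuous_ofReal.comp (Continuous.inv₀ (by fun_prop) fun v => ?_)
  positivity

theorem fermiFn_eq {v : ℝ} (hv : 0 < v) : fermiFn v = boseFn v - (2 : ℂ) • boseFn (2 * v) := by
  have h3 : 1 < Real.exp v := Real.one_lt_exp_iff.2 hv
  have h4 : (Real.exp v - 1)⁻¹ - 2 * (Real.exp (2 * v) - 1)⁻¹ = (Real.exp v + 1)⁻¹ := by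
    have h5 : Real.exp (2 * v) - 1 = (Real.exp v - 1) * (Real.exp v + 1) := by
      rw [two_mul, Real.exp_add]; ring
    have h6 : Real.exp v - 1 ≠ 0 := by linarith
    have h7 : Real.exp v + 1 ≠ 0 := by linarith
    rw [h5]; field_simp; ring
  rw [fermiFn, ← h4, boseFn, boseFn, smul_eq_mul]
  push_cast; ring

theorem mellinConvergent_boseFn {s : ℂ} (hs : 1 < s.re) : MellinConvergent boseFn s := by
  refine mellinConvergent_of_isBigO_rpow_exp (a := 1) (b := 1) one_pos ?_ ?_ ?_ hs
  · refine ContinuousOn.locallyIntegrableOn ?_ measurableSet_Ioi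
    refine Complex.continuous_ofReal.comp_continuousOn (ContinuousOn.inv₀ (by fun_prop) fun v hv => ?_)
    have : 1 < Real.exp v := Real.one_lt_exp_iff.2 hv
    linarith
  · refine Asymptotics.IsBigO.of_bound 2 ?_
    filter_upwards [eventually_ge_atTop 1] with v hv
    have h1 := Real.add_one_le_exp v
    rw [boseFn, Complex.norm_real, Real.norm_of_nonneg (inv_nonneg.2 (by linarith)),
      Real.norm_of_nonneg (Real.exp_pos _).le, neg_one_mul, Real.exp_neg, ← div_eq_mul_inv,
      inv_eq_one_div, div_le_div_iff₀ (by linarith) (Real.exp_pos _)]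
    linarith
  · refine Asymptotics.IsBigO.of_bound 1 ?_
    filter_upwards [self_mem_nhdsWithin] with v hv
    have hv : 0 < v := hv
    have h1 := Real.add_one_le_exp v
    rw [boseFn, Complex.norm_real, Real.norm_of_nonneg (inv_nonneg.2 (by linarith)),
      Real.norm_of_nonneg (by positivity), one_mul, Real.rpow_neg_one]
    exact inv_anti₀ hv (by linarith)

theorem mellin_boseFn {s : ℂ} (hs : 1 < s.re) :
    mellin boseFn s = Complex.Gamma s * riemannZeta s := by
  have h := hasSum_mellin (ι := ℕ+) (a := fun _ => 1) (p := fun k => (k : ℝ)) (F := boseFn) (s := s)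
    (fun k => Or.inr (by positivity)) (by linarith)
    (fun t ht => by
      have h1 := Complex.hasSum_ofReal.2 (hasSum_exp_neg_pnat (v := t) ht)
      simpa [boseFn] using h1)
    (by
      have h2 : Summable fun n : ℕ => 1 / (n : ℝ) ^ s.re := Real.summable_one_div_nat_rpow.2 hs
      simpa [Function.comp_def] using h2.comp_injective PNat.coe_injective)
  rw [← h.tsum_eq, zeta_eq_tsum_one_div_nat_add_one_cpow hs, ← tsum_mul_left]
  rw [tsum_pnat_eq_tsum_succ (f := fun n : ℕ => Complex.Gamma s * 1 / ((n : ℝ) : ℂ) ^ s)]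
  refine tsum_congr fun n => ?_
  push_cast
  rw [mul_div_assoc]

/-- The Bose function has Mellin transform Γζ, and its dilate by 2 contributes the factor 2^{-s},
whence 1 - 2·2^{-s}. -/
theorem mellin_fermiFn_of_one_lt_re {s : ℂ} (hs : 1 < s.re) :
    mellin fermiFn s = Complex.Gamma s * (1 - 2 ^ (1 - s)) * riemannZeta s := by
  have h0 := mellinConvergent_boseFn hs
  have h1 : MellinConvergent (fun v => boseFn (2 * v)) s :=
    (MellinConvergent.comp_mul_left two_pos).2 h0
  have h2 : mellin fermiFn s = mellin (fun v => boseFn v - (2 : ℂ) • boseFn (2 * v)) s :=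
    setIntegral_congr_fun measurableSet_Ioi fun v hv => by simp only [fermiFn_eq hv]
  rw [h2, (hasMellin_sub h0 (h1.const_smul _)).2, mellin_const_smul, mellin_comp_mul_left _ _ two_pos,
    mellin_boseFn hs, sub_eq_add_neg (1 : ℂ) s, Complex.cpow_add _ _ two_ne_zero, Complex.cpow_one]
  simp only [smul_eq_mul, Complex.ofReal_ofNat]
  ring

theorem differentiableAt_mellin_fermiFn {s : ℂ} (hs : 0 < s.re) :
    DifferentiableAt ℂ (mellin fermiFn) s := by
  refine mellin_differentiableAt_of_isBigO_rpow_exp (a := 1) (b := 0) one_pos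
    (continuous_fermiFn.locallyIntegrable.locallyIntegrableOn _) ?_ ?_ hs
  · refine Asymptotics.IsBigO.of_bound 1 (Eventually.of_forall fun v => ?_)
    rw [fermiFn, Complex.norm_real, Real.norm_of_nonneg (by positivity),
      Real.norm_of_nonneg (Real.exp_pos _).le, one_mul, neg_one_mul]
    exact inv_exp_add_one_le v
  · refine Asymptotics.IsBigO.of_bound 1 (Eventually.of_forall fun v => ?_)
    rw [fermiFn, Complex.norm_real, Real.norm_of_nonneg (by positivity), neg_zero, Real.rpow_zero,
      norm_one, one_mul]
    exact inv_le_one_of_one_le₀ (by linarith [Real.exp_pos v])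

/-- Analytic continuation from Re s > 1; the factor s - 1 removes the pole of ζ, so s = 1 needs no
exception. -/
theorem sub_one_mul_mellin_fermiFn {s : ℂ} (hs : 0 < s.re) :
    (s - 1) * mellin fermiFn s = Complex.Gamma s * (1 - 2 ^ (1 - s)) * riemannZeta₁ s := by
  have ho : IsOpen {s : ℂ | 0 < s.re} := isOpen_lt continuous_const Complex.continuous_re
  have h1 : AnalyticOnNhd ℂ (fun s => (s - 1) * mellin fermiFn s) {s : ℂ | 0 < s.re} := by
    refine DifferentiableOn.analyticOnNhd (fun s hs => ?_) ho
    have := differentiableAt_mellin_fermiFn hs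
    exact DifferentiableAt.differentiableWithinAt (by fun_prop)
  have h2 : AnalyticOnNhd ℂ (fun s => Complex.Gamma s * (1 - 2 ^ (1 - s)) * riemannZeta₁ s)
      {s : ℂ | 0 < s.re} := by
    refine DifferentiableOn.analyticOnNhd (fun s hs => ?_) ho
    have hs : 0 < s.re := hs
    have hG : DifferentiableAt ℂ Complex.Gamma s := Complex.differentiableAt_Gamma _ fun m hm => by
      rw [hm] at hs
      simp at hs
      linarith [m.cast_nonneg (α := ℝ)]
    have h2 : DifferentiableAt ℂ (fun s : ℂ => (2 : ℂ) ^ (1 - s)) s :=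
      DifferentiableAt.const_cpow (by fun_prop) (Or.inl two_ne_zero)
    exact DifferentiableAt.differentiableWithinAt (by fun_prop)
  refine h1.eqOn_of_preconnected_of_eventuallyEq h2
    (convex_halfSpace_re_gt 0).isPreconnected (z₀ := 2) (by simp) ?_ hs
  have : {s : ℂ | 1 < s.re} ∈ 𝓝 (2 : ℂ) :=
    (isOpen_lt continuous_const Complex.continuous_re).mem_nhds (by simp)
  filter_upwards [this] with s hs
  have hs : 1 < s.re := hs
  have hs1 : s ≠ 1 := by rintro rfl; simp at hs
  rw [mellin_fermiFn_of_one_lt_re hs, riemannZeta₁_eq_sub_one_mul hs1]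
  ring

/-- Γ has no zeros, RH excludes those of ζ, and |2^{1-s}| = 2^{1 - Re s} > 1 because Re s < 1. -/
theorem mellin_fermiFn_ne_zero (hRH : RiemannHypothesis) {s : ℂ} (hs : 1 / 2 < s.re)
    (hs1 : s.re < 1) : mellin fermiFn s ≠ 0 := by
  intro h
  have h1 := sub_one_mul_mellin_fermiFn (s := s) (by linarith)
  rw [h, mul_zero] at h1
  refine mul_ne_zero (mul_ne_zero (Complex.Gamma_ne_zero_of_re_pos (by linarith)) ?_)
    (riemannZeta₁_ne_zero hRH hs) h1.symm
  intro h2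
  have h3 : ‖(2 : ℂ) ^ (1 - s)‖ = 2 ^ (1 - s.re) := by
    simpa using Complex.norm_cpow_eq_rpow_re_of_pos (two_pos : (0 : ℝ) < 2) (1 - s)
  rw [← sub_eq_zero.1 h2, norm_one] at h3
  exact (Real.one_lt_rpow one_lt_two (by linarith : 0 < 1 - s.re)).ne h3

/-! ### Uniqueness by Plancherel. -/

/-- The convolution kernel of the integral equation. -/
noncomputable def salemKernel (σ u : ℝ) : ℝ := Real.exp (-σ * u) * (Real.exp (Real.exp (-u)) + 1)⁻¹

theorem continuous_salemKernel (σ : ℝ) : Continuous (salemKernel σ) := by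
  refine Continuous.mul (by fun_prop) (Continuous.inv₀ (by fun_prop) fun v => ?_)
  positivity

theorem salemKernel_pos (σ u : ℝ) : 0 < salemKernel σ u := by
  unfold salemKernel; positivity

theorem salemKernel_le_of_nonneg (σ : ℝ) (u : ℝ) : salemKernel σ u ≤ Real.exp (-σ * u) := by
  refine mul_le_of_le_one_right (Real.exp_pos _).le (inv_le_one_of_one_le₀ ?_)
  linarith [Real.exp_pos (Real.exp (-u))]

theorem salemKernel_le_of_nonpos {σ : ℝ} (hσ1 : σ < 1) {u : ℝ} (hu : u ≤ 0) :
    salemKernel σ u ≤ 2 * Real.exp (1 * u) := by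
  have h1 := inv_exp_add_one_le (Real.exp (-u))
  have h2 : Real.exp (-Real.exp (-u)) ≤ 2 * Real.exp (2 * u) := by
    -- The inequality e^v ≥ v²/2 at v = e^{-u} gives decay e^{2u}, which beats the weight e^{-σu} as
    -- σ < 1.
    have h3 := Real.quadratic_le_exp_of_nonneg (Real.exp_pos (-u)).le
    have h4 : Real.exp (-u) ^ 2 * Real.exp (2 * u) = 1 := by
      rw [← Real.exp_nat_mul, ← Real.exp_add]
      rw [Real.exp_eq_one_iff]; push_cast; ring
    rw [Real.exp_neg, inv_le_iff_one_le_mul₀ (Real.exp_pos _)]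
    have h5 : Real.exp (-u) ^ 2 ≤ 2 * Real.exp (Real.exp (-u)) := by
      linarith [Real.exp_pos (-u)]
    nlinarith [Real.exp_pos (2 * u)]
  calc salemKernel σ u ≤ Real.exp (-σ * u) * (2 * Real.exp (2 * u)) := by
        unfold salemKernel; gcongr; exact h1.trans h2
    _ = 2 * Real.exp ((2 - σ) * u) := by
      rw [mul_left_comm, ← Real.exp_add]; congr 2; ring
    _ ≤ _ := by
      have : (2 - σ) * u ≤ 1 * u := by nlinarith
      gcongr

theorem integrable_salemKernel {σ : ℝ} (hσ : 0 < σ) (hσ1 : σ < 1) :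
    Integrable (salemKernel σ) := by
  rw [← integrableOn_univ, ← Set.Iic_union_Ioi (a := (0 : ℝ))]
  refine IntegrableOn.union ?_ ?_
  · refine Integrable.mono' ((integrableOn_exp_mul_Iic one_pos 0).const_mul 2)
      (continuous_salemKernel σ).aestronglyMeasurable ?_
    refine (ae_restrict_iff' measurableSet_Iic).2 (ae_of_all _ fun u hu => ?_)
    rw [Real.norm_of_nonneg (salemKernel_pos σ u).le]
    exact salemKernel_le_of_nonpos hσ1 hu
  · refine Integrable.mono' (integrableOn_exp_mul_Ioi (a := -σ) (by linarith) 0)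
      (continuous_salemKernel σ).aestronglyMeasurable (ae_of_all _ fun u => ?_)
    rw [Real.norm_of_nonneg (salemKernel_pos σ u).le]
    exact salemKernel_le_of_nonneg σ u

theorem salemKernel_le_two {σ : ℝ} (hσ : 0 < σ) (hσ1 : σ < 1) (u : ℝ) : salemKernel σ u ≤ 2 := by
  rcases le_total u 0 with hu | hu
  · refine (salemKernel_le_of_nonpos hσ1 hu).trans ?_
    have : Real.exp (1 * u) ≤ 1 := Real.exp_le_one_iff.2 (by linarith)
    linarith
  · refine (salemKernel_le_of_nonneg σ u).trans ?_
    have : Real.exp (-σ * u) ≤ 1 := Real.exp_le_one_iff.2 (by nlinarith)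
    linarith

theorem memLp_salemKernel {σ : ℝ} (hσ : 0 < σ) (hσ1 : σ < 1) :
    MemLp (fun u => (salemKernel σ u : ℂ)) 2 := by
  have hc : Continuous fun u => (salemKernel σ u : ℂ) :=
    Complex.continuous_ofReal.comp (continuous_salemKernel σ)
  rw [memLp_two_iff_integrable_sq_norm hc.aestronglyMeasurable]
  refine ((integrable_salemKernel hσ hσ1).const_mul 2).mono' (hc.norm.pow 2).aestronglyMeasurable
    (ae_of_all _ fun u => ?_)
  have h1 := salemKernel_le_two hσ hσ1 u
  have h2 := salemKernel_pos σ u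
  rw [Complex.norm_real, Real.norm_of_nonneg (by positivity), Real.norm_of_nonneg h2.le]
  nlinarith

/-- The substitution v = e^{-u} identifies the Mellin transform on Re s = σ with a Fourier
transform. -/
theorem fourier_salemKernel (σ ξ : ℝ) :
    FourierTransform.fourier (fun u => (salemKernel σ u : ℂ)) ξ =
      mellin fermiFn (σ + Complex.I * ((2 * Real.pi * ξ : ℝ) : ℂ)) := by
  rw [mellin_eq_fourier]
  have h1 : ((σ : ℂ) + Complex.I * ((2 * Real.pi * ξ : ℝ) : ℂ)).re = σ := by simp
  have h2 : ((σ : ℂ) + Complex.I * ((2 * Real.pi * ξ : ℝ) : ℂ)).im = 2 * Real.pi * ξ := by simp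
  rw [h1, h2, mul_div_cancel_left₀ _ (by positivity)]
  refine congrFun (congrArg _ (funext fun u => ?_)) ξ
  rw [fermiFn, salemKernel, Complex.real_smul]
  push_cast; ring

open ComplexConjugate in
/-- An `L²` function orthogonal to almost all translates of `K ∈ L¹ ∩ L²` vanishes, if the Fourier
transform of `K` has no zero. -/
theorem ae_eq_zero_of_integral_translate_eq_zero {K δ : ℝ → ℂ} (hK : Integrable K)
    (hK2 : MemLp K 2) (hK0 : ∀ ξ, FourierTransform.fourier K ξ ≠ 0) (hδ : MemLp δ 2)
    (h : ∀ᵐ x : ℝ, ∫ y, conj (K (y - x)) * δ y = 0) : δ =ᵐ[volume] 0 := by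
  set D : Lp (α := ℝ) ℂ 2 := FourierTransform.fourier (hδ.toLp δ) with hD
  have hKf2 : MemLp (FourierTransform.fourier K) 2 :=
    (memLp_congr_ae (coeFn_fourier_toLp_ae_eq hK hK2)).1 (Lp.memLp _)
  set P : ℝ → ℂ := fun ξ => conj (FourierTransform.fourier K ξ) * D ξ with hP
  have hPi : Integrable P := hKf2.star.integrable_mul (Lp.memLp D)
  -- By Plancherel the inverse transform of P at x is the inner product of the translate K(· - x)
  -- with δ; the translation becomes the phase e^{2πixξ}.
  have hPx : ∀ᵐ x : ℝ, FourierTransform.fourierInv P x = 0 := by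
    filter_upwards [h] with x hx
    have hτ : Integrable fun y => K (y - x) := hK.comp_sub_right x
    have hτ2 : MemLp (fun y => K (y - x)) 2 :=
      hK2.comp_measurePreserving (measurePreserving_sub_right volume x)
    have hin := Lp.inner_fourier_eq (hτ2.toLp _) (hδ.toLp δ)
    have hright : inner ℂ (hτ2.toLp _) (hδ.toLp δ) = 0 := by
      rw [L2.inner_def, ← hx]
      refine integral_congr_ae ?_
      filter_upwards [hτ2.coeFn_toLp, hδ.coeFn_toLp] with y h1 h2
      rw [h1, h2, RCLike.inner_apply, mul_comm]
    rw [hright, L2.inner_def] at hin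
    rw [Real.fourierInv_eq', ← hin]
    refine integral_congr_ae ?_
    filter_upwards [coeFn_fourier_toLp_ae_eq hτ hτ2] with ξ h1
    have h2 : FourierTransform.fourier (fun y => K (y - x)) ξ =
        Complex.exp (((-2 * Real.pi * x * ξ : ℝ) : ℂ) * Complex.I) *
          FourierTransform.fourier K ξ := by
      rw [Real.fourier_real_eq_integral_exp_smul, Real.fourier_real_eq_integral_exp_smul,
        ← integral_const_mul, ← integral_sub_right_eq_self (fun v : ℝ =>
          Complex.exp (((-2 * Real.pi * x * ξ : ℝ) : ℂ) * Complex.I) *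
          (Complex.exp (((-2 * Real.pi * v * ξ : ℝ) : ℂ) * Complex.I) • K v)) x]
      congr 1
      ext y
      rw [smul_eq_mul, smul_eq_mul, ← mul_assoc, ← Complex.exp_add]
      congr 2
      push_cast; ring
    have h3 : (inner ℝ ξ x : ℝ) = x * ξ := by simp
    have h4 : conj (Complex.exp (((-2 * Real.pi * x * ξ : ℝ) : ℂ) * Complex.I)) =
        Complex.exp (((2 * Real.pi * (x * ξ) : ℝ) : ℂ) * Complex.I) := by
      rw [← Complex.exp_conj, map_mul, Complex.conj_ofReal, Complex.conj_I]
      congr 1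
      push_cast; ring
    have h5 (a b : ℂ) : inner ℂ a b = conj a * b := by rw [RCLike.inner_apply, mul_comm]
    have h6 : (FourierTransform.fourier (hτ2.toLp fun y => K (y - x)) : Lp (α := ℝ) ℂ 2) ξ =
        FourierTransform.fourier (fun y => K (y - x)) ξ := h1
    rw [h5, h6, h2, map_mul, h4, h3, smul_eq_mul]
    exact (mul_assoc _ _ _).symm
  have hcont : Continuous (FourierTransform.fourierInv P) := by
    have : FourierTransform.fourierInv P = fun x => FourierTransform.fourier P (-x) := by
      ext x
      exact Real.fourierInv_eq_fourier_neg P x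
    rw [this]
    exact (VectorFourier.fourierIntegral_continuous Real.continuous_fourierChar
      continuous_inner hPi).comp continuous_neg
  have hP0 : ∀ᵐ ξ, P ξ = 0 := by
    refine ae_eq_zero_of_fourier_eq_zero hPi fun x => ?_
    -- P is integrable, so its inverse transform is continuous and its vanishing almost everywhere
    -- is vanishing everywhere.
    have := (Continuous.ae_eq_iff_eq volume hcont continuous_const).1
      (show FourierTransform.fourierInv P =ᵐ[volume] fun _ => (0 : ℂ) from hPx)
    have h2 := congrFun this (-x)
    rwa [Real.fourierInv_eq_fourier_neg, neg_neg] at h2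
  have hD0 : D = 0 := by
    rw [Lp.eq_zero_iff_ae_eq_zero]
    filter_upwards [hP0] with ξ hξ
    exact (mul_eq_zero.1 hξ).resolve_left ((map_ne_zero _).2 (hK0 ξ))
  have h0 : hδ.toLp δ = 0 := by
    rw [← norm_eq_zero, ← Lp.norm_fourier_eq, ← hD, hD0, norm_zero]
  exact (MemLp.toLp_eq_toLp_iff hδ MemLp.zero).1 (by rw [h0]; rfl)

theorem exp_mul_salemIntegrand (σ x : ℝ) (φ : ℝ → ℂ) (y : ℝ) :
    ((Real.exp (σ * x) : ℝ) : ℂ) * salemIntegrand σ φ x y = (salemKernel σ (y - x) : ℂ) * φ y := by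
  rw [salemIntegrand, ← mul_assoc, ← Complex.ofReal_mul, salemKernel, ← mul_div_assoc,
    ← Real.exp_add, div_eq_mul_inv, neg_sub]
  congr 5
  ring

/-- Uniqueness of square integrable solutions. -/
theorem ae_eq_of_ae_solvesSalemAt (hRH : RiemannHypothesis) {σ : ℝ} (hσ : 1 / 2 < σ) (hσ1 : σ < 1)
    {ψ φ : ℝ → ℂ} (hψ : MemLp ψ 2) (hφ : MemLp φ 2) (hψs : ∀ᵐ x, SolvesSalemAt σ ψ x)
    (hφs : ∀ᵐ x, SolvesSalemAt σ φ x) : ψ =ᵐ[volume] φ := by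
  have key := ae_eq_zero_of_integral_translate_eq_zero
    (K := fun u => (salemKernel σ u : ℂ)) (δ := ψ - φ)
    (integrable_salemKernel (by linarith) hσ1).ofReal (memLp_salemKernel (by linarith) hσ1)
    (fun ξ => by
      rw [fourier_salemKernel]
      exact mellin_fermiFn_ne_zero hRH (by simpa using hσ) (by simpa using hσ1))
    (hψ.sub hφ) (by
      filter_upwards [hψs, hφs] with x h1 h2
      have h3 : ∀ y, (starRingEnd ℂ) (salemKernel σ (y - x) : ℂ) * (ψ - φ) y =
          ((Real.exp (σ * x) : ℝ) : ℂ) * (salemIntegrand σ ψ x y - salemIntegrand σ φ x y) := by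
        intro y
        rw [Complex.conj_ofReal, mul_sub, exp_mul_salemIntegrand, exp_mul_salemIntegrand,
          Pi.sub_apply, mul_sub]
      simp_rw [h3]
      rw [integral_const_mul, integral_sub h1.1 h2.1, mul_sub, ← h1.2, ← h2.2, sub_self])
  filter_upwards [key] with x hx
  exact sub_eq_zero.1 hx

theorem mainTheorem5 (hRH : RiemannHypothesis) (σ : ℝ) (hσ : 1 / 2 < σ) (hσ' : σ < 1) :
    MemLp (zetaSymbol σ) 2 volume ∧
    ∃ φ : ℝ → ℂ,
      -- the values of the solution
      (∀ x : ℝ, x < 0 →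
        φ x = -((Real.exp (σ * x) : ℝ) : ℂ) * ((mertens (Real.exp (-x)) : ℤ) : ℂ)) ∧
      (∀ x : ℝ, 0 < x → φ x = 0) ∧
      -- the Fourier representation, away from the jumps of the Mertens function
      (∀ x : ℝ, (∀ n : ℕ, Squarefree n → x ≠ -Real.log n) →
        ∃ I : ℂ,
          HasImproperIntegral (fun y : ℝ => Complex.exp (-Complex.I * x * y) * zetaSymbol σ y) I ∧
          φ x = -(1 / (2 * (Real.pi : ℂ))) * I) ∧
      -- `φ` is square integrable and solves the equation at every point
      MemLp φ 2 volume ∧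
      (∀ x : ℝ, SolvesSalemAt σ φ x) ∧
      -- and it is the only square integrable solution, up to null sets
      (∀ ψ : ℝ → ℂ, MemLp ψ 2 volume → (∀ᵐ x : ℝ, SolvesSalemAt σ ψ x) → ψ =ᵐ[volume] φ) := by
  have hmem := memLp_salemSolution hRH hσ hσ'
  refine ⟨(memLp_zetaSymbol hRH hσ hσ').2, salemSolution σ, fun x _ => rfl,
    fun x hx => salemSolution_of_pos σ hx, fun x hx => ?_, hmem,
    solvesSalemAt_salemSolution σ, fun ψ hψ hs => ?_⟩
  · refine ⟨_, hasImproperIntegral_zetaSymbol hRH hσ hσ' hx, ?_⟩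
    have : (Real.pi : ℂ) ≠ 0 := by exact_mod_cast Real.pi_ne_zero
    rw [salemSolution]
    field_simp
  · exact ae_eq_of_ae_solvesSalemAt hRH hσ hσ' hψ hmem hs
      (ae_of_all _ (solvesSalemAt_salemSolution σ))
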